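/- **Conventions.** A *Lie 2-algebra* is a 2-term complex of real vector spaces $\partial:W\to V$ with a skew bilinear bracket $[\cdot,\cdot]:V\times V\to V$, a bilinear map $[\cdot,\cdot]:V\times W\to W$ (with $[w,v]:=-[v,w]$) and an alternating trilinear map $l_3:V^3\to W$ satisfying the axioms of an $L_\infty$-algebra concentrated in two degrees; signs are normalised so that $[[x,y],z]+[[y,z],x]+[[z,x],y]=\partial l_3(x,y,z)$. A *homomorphism* of Lie 2-algebras is an $L_\infty$-morphism $(\varphi_0,\varphi_1,\varphi_2)$: a chain map preserving the brackets up to the coherent skew bilinear homotopy $\varphi_2:V\times V\to W'$. **Setting.** Let $M$ be a finite-dimensional smooth manifold without boundary, Hausdorff and $\sigma$-compact, let $\{U_\alpha\}$ be an open cover, and let $\mathcal M$ be the gerbe with connective structure given by Čech data $\Lambda_{\alpha\beta}\in\Omega^1(U_\alpha\cap U_\beta)$, $G_{\alpha\beta\gamma}\in C^\infty(U_\alpha\cap U_\beta\cap U_\gamma)$, antisymmetric in their indices, with $\Lambda_{\alpha\beta}+\Lambda_{\beta\gamma}+\Lambda_{\gamma\alpha}=dG_{\alpha\beta\gamma}$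 and $G_{\alpha\beta\gamma}-G_{\beta\gamma\delta}+G_{\gamma\delta\alpha}-G_{\delta\alpha\beta}\in 2\pi\mathbb Z$. * $\mathbf H(M,\mathbf B\mathbb R_{\rm conn})$ is the abelian Lie 2-algebra of line bundles with connection: degree-0 elements are families $(\xi_\alpha,f_{\alpha\beta})$, $\xi_\alpha\in\Omega^1(U_\alpha)$, $f_{\alpha\beta}\in C^\infty(U_\alpha\cap U_\beta)$, with $\xi_\alpha-\xi_\beta=df_{\alpha\beta}$ and $f_{\alpha\beta}+f_{\beta\gamma}+f_{\gamma\alpha}=0$; degree-1 elements are families $\varepsilon=(\varepsilon_\alpha)$, $\varepsilon_\alpha\in C^\infty(U_\alpha)$, with $\partial\varepsilon=(d\varepsilon_\alpha,\varepsilon_\alpha-\varepsilon_\beta)$. * $\mathfrak{at}(\mathcal M)$ is the Lie 2-algebra of infinitesimal automorphisms of $\mathcal M$: degree-0 elements are $(X,\xi_\alpha,\eta_{\alpha\beta})$ with $X\in\mathfrak X(M)$, $\xi_\alpha\in\Omega^1(U_\alpha)$, $\eta_{\alpha\beta}\in C^\infty(U_\alpha\cap U_\beta)$ such that $$\xi_\alpha-\xi_\beta=-\mathcal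 L_X\Lambda_{\alpha\beta}+d\eta_{\alpha\beta},\qquad \eta_{\alpha\beta}+\eta_{\beta\gamma}+\eta_{\gamma\alpha}=\mathcal L_XG_{\alpha\beta\gamma};$$ degree-1 elements are $\varepsilon=(\varepsilon_\alpha)$ with $\partial\varepsilon=(0,d\varepsilon_\alpha,\varepsilon_\alpha-\varepsilon_\beta)$; the native brackets are $[(X,a),(Y,b)]=([X,Y],\mathcal L_Xb-\mathcal L_Ya)$, $[(X,a),\varepsilon]=X(\varepsilon)$, $l_3=0$. * The maps $i:(\xi,f)\mapsto(0,\xi,f)$ and $p:(X,\xi,\eta)\mapsto X$ form the higher Atiyah sequence $0\to\mathbf H(M,\mathbf B\mathbb R_{\rm conn})\xrightarrow{i}\mathfrak{at}(\mathcal M)\xrightarrow{p}\mathfrak X(M)\to0$ (identity, respectively zero, in degree 1; $\mathfrak X(M)$ is concentrated in degree 0). * The standard Courant 2-algebra is the complex $C^\bullet=\mathfrak X(M)\oplus\mathbf H(M,\mathbf B\mathbb R_{\rm conn})$, $\partial\varepsilon=(0,d\varepsilon_\alpha,\varepsilon_\alpha-\varepsilon_\beta)$, with $$[(X+\xi_\alpha,f_{\alpha\beta}),(Y+\eta_\alpha,g_{\alpha\beta})]_{\rm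 std}=\Big([X,Y]+\mathcal L_X\eta_\alpha-\mathcal L_Y\xi_\alpha-\tfrac12d(\iota_X\eta_\alpha-\iota_Y\xi_\alpha),\ \tfrac12X(g_{\alpha\beta})-\tfrac12Y(f_{\alpha\beta})\Big),$$ $$[(X+\xi_\alpha,f_{\alpha\beta}),(\varepsilon_\alpha)]_{\rm std}=\tfrac12X(\varepsilon_\alpha),$$ $$[(X+\xi,f),(Y+\eta,g),(Z+\zeta,h)]_{\rm std}=\tfrac1{3!}\Big(\tfrac32\iota_X\iota_Yd\zeta_\alpha+\tfrac32\iota_Xd\iota_Y\zeta_\alpha\pm\text{perm.}\Big),$$ the last sum being over all permutations of the three arguments, with signs. **Theorem (general Courant 2-algebroid).** 0. $\mathbf H(M,\mathbf B\mathbb R_{\rm conn})$, $\mathfrak{at}(\mathcal M)$, $\mathfrak X(M)$ and the standard Courant 2-algebra are Lie 2-algebras, and the higher Atiyah sequence is a short exact sequence of Lie 2-algebras. 1. (Sections.) Put $f_{\alpha\beta}:=\eta_{\alpha\beta}-\iota_X\Lambda_{\alpha\beta}$. Then $(X,\xi_\alpha,\eta_{\alpha\beta})\mapsto(X+\xi_\alpha,f_{\alpha\beta})$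 is a bijection from the degree-0 elements of $\mathfrak{at}(\mathcal M)$ onto the families with $X\in\mathfrak X(M)$, $\xi_\alpha\in\Omega^1(U_\alpha)$, $f_{\alpha\beta}\in C^\infty(U_\alpha\cap U_\beta)$ glued by $$\xi_\alpha-\xi_\beta=-\iota_Xd\Lambda_{\alpha\beta}+df_{\alpha\beta},\qquad f_{\alpha\beta}+f_{\beta\gamma}+f_{\gamma\alpha}=0.$$ 2. (Morphisms.) In these coordinates $\varepsilon=(\varepsilon_\alpha)$ is a morphism from one section to another, i.e. the target is the source plus $\partial\varepsilon$, if and only if the target is obtained from the source by the gauge transformation $(X+\xi_\alpha,f_{\alpha\beta})\mapsto(X+\xi_\alpha+d\varepsilon_\alpha,\ f_{\alpha\beta}+\varepsilon_\alpha-\varepsilon_\beta)$. 3. (Brackets.) Let $s:\mathfrak X(M)\to\mathfrak{at}(\mathcal M)$ be any splitting, i.e. a linear map into degree 0 with $p\circ s=\mathrm{id}$. Then $\Phi=s\oplus i$ (with the identity in degree 1) is an isomorphism of complexes from the standard Courant 2-algebra onto $\mathfrak{at}(\mathcal M)$, and the brackets transported along it, $$[\![s(X)+i(\xi,f),\,s(Y)+i(\eta,g)]\!]:=\Phi\big([(X+\xi_\alpha,f_{\alpha\beta}),(Y+\eta_\alpha,g_{\alpha\beta})]_{\rm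 std}\big)$$ and analogously for the other brackets, make the complex $\mathfrak{at}(\mathcal M)$ a Lie 2-algebra to which the standard Courant 2-algebra is strictly isomorphic by $\Phi$. If moreover $s$ is a homomorphism of Lie 2-algebras for the native brackets (i.e. it extends to one by some $s_2$), then $\Phi$ extends, by some $\varphi_2$, to an isomorphism of Lie 2-algebras from the standard Courant 2-algebra to $\mathfrak{at}(\mathcal M)$ with its native brackets, and the identity of the complex $\mathfrak{at}(\mathcal M)$ extends likewise to an isomorphism from the transported to the native Lie 2-algebra structure. -/

import Mathlib

open scoped Manifold ContDiff Topology
open Bundle VectorField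

noncomputable section
namespace HigherAtiyah

set_option linter.unusedSectionVars false
section Calculus

variable {E : Type*} [NormedAddCommGroup E] [NormedSpace ℝ E] [FiniteDimensional ℝ E]
  {M : Type*} [TopologicalSpace M] [ChartedSpace E M]

/-- The cotangent space `T*_x M`. -/
abbrev Covec (E : Type*) [NormedAddCommGroup E] [NormedSpace ℝ E]
    {M : Type*} [TopologicalSpace M] [ChartedSpace E M] (x : M) : Type _ :=
  TangentSpace 𝓘(ℝ, E) x →L[ℝ] ℝ

/-- The differential of a function. -/
def dFun (f : M → ℝ) (x : M) : Covec E x := mfderiv 𝓘(ℝ, E) 𝓘(ℝ, ℝ) f x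

variable [IsManifold 𝓘(ℝ, E) ∞ M]

/-- `θ` is, near `x`, a smooth section of the cotangent bundle. -/
def SmoothCovecAt (θ : ∀ x : M, Covec E x) (x : M) : Prop :=
  ContMDiffAt 𝓘(ℝ, E) (𝓘(ℝ, E).prod 𝓘(ℝ, E →L[ℝ] ℝ)) ∞
    (fun x => TotalSpace.mk' (E →L[ℝ] ℝ) (E := fun x : M => (TangentSpace 𝓘(ℝ, E) x →L[ℝ] Bundle.Trivial M ℝ x)) x (θ x)) x

/-- `X` is smooth at `x` as a section of the tangent bundle. -/
def SmoothVecAt (X : ∀ x : M, TangentSpace 𝓘(ℝ, E) x) (x : M) : Prop :=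
  ContMDiffAt 𝓘(ℝ, E) (𝓘(ℝ, E).prod 𝓘(ℝ, E)) ∞ (fun x => TotalSpace.mk' E x (X x)) x

/-- The pullback of `θ` to `E` along the inverse of the preferred chart at `x`. -/
def chartRep (θ : ∀ x : M, Covec E x) (x : M) (y : E) : E →L[ℝ] ℝ :=
  (θ ((extChartAt 𝓘(ℝ, E) x).symm y)).comp
    (mfderiv 𝓘(ℝ, E) 𝓘(ℝ, E) (extChartAt 𝓘(ℝ, E) x).symm y)

/-- The exterior derivative of a 1-form at `x`, `dθ (v, w) = extDer θ x v w`, computed in the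
preferred chart at `x`; the tangent space at `x` is `E` through that same chart. -/
def extDer (θ : ∀ x : M, Covec E x) (x : M) :
    E →L[ℝ] E →L[ℝ] ℝ :=
  fderiv ℝ (chartRep θ x) (extChartAt 𝓘(ℝ, E) x x) -
    (fderiv ℝ (chartRep θ x) (extChartAt 𝓘(ℝ, E) x x)).flip

/-- The local frame of the tangent bundle around `x` (constant fields of the preferred chart). -/
def frame (x : M) (v : E) (m : M) : TangentSpace 𝓘(ℝ, E) m :=
  (trivializationAt E (TangentSpace 𝓘(ℝ, E)) x).symmL ℝ m v

/-- The coefficients of `θ` in that frame. -/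
def coframe (θ : ∀ x : M, Covec E x) (x : M) (m : M) : E →L[ℝ] ℝ :=
  (θ m).comp ((trivializationAt E (TangentSpace 𝓘(ℝ, E)) x).symmL ℝ m)

lemma smoothCovecAt_iff {θ : ∀ x : M, Covec E x} {x : M} :
    SmoothCovecAt θ x ↔ ContMDiffAt 𝓘(ℝ, E) 𝓘(ℝ, E →L[ℝ] ℝ) ∞ (coframe θ x) x := by
  unfold SmoothCovecAt
  rw [contMDiffAt_hom_bundle]
  refine ⟨fun h => ?_, fun h => ⟨contMDiffAt_id, ?_⟩⟩
  · refine h.2.congr_of_eventuallyEq (Filter.Eventually.of_forall fun m => ?_)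
    ext v
    simp [ContinuousLinearMap.inCoordinates, coframe]
  · refine h.congr_of_eventuallyEq (Filter.Eventually.of_forall fun m => ?_)
    ext v
    simp [ContinuousLinearMap.inCoordinates, coframe]

lemma target_nhds (x : M) :
    (extChartAt 𝓘(ℝ, E) x).target ∈ 𝓝 (extChartAt 𝓘(ℝ, E) x x) :=
  extChartAt_target_mem_nhds x

lemma chartRep_smooth {θ : ∀ x : M, Covec E x} {x : M} (h : SmoothCovecAt θ x) :
    ContDiffAt ℝ ∞ (chartRep θ x) (extChartAt 𝓘(ℝ, E) x x) := by
  rw [smoothCovecAt_iff] at h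
  rw [← contMDiffAt_iff_contDiffAt]
  have h2 : ContMDiffAt 𝓘(ℝ, E) 𝓘(ℝ, E) ∞ (extChartAt 𝓘(ℝ, E) x).symm (extChartAt 𝓘(ℝ, E) x x) :=
    (contMDiffOn_extChartAt_symm x).contMDiffAt (target_nhds x)
  have h3 := ContMDiffAt.comp (extChartAt 𝓘(ℝ, E) x x) (by simpa using h) h2
  refine h3.congr_of_eventuallyEq ?_
  filter_upwards [target_nhds (E := E) x] with y hy
  have hs : (extChartAt 𝓘(ℝ, E) x).symm y ∈ (chartAt E x).source := by
    rw [← extChartAt_source 𝓘(ℝ, E)]; exact (extChartAt 𝓘(ℝ, E) x).map_target hy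
  have := TangentBundle.symmL_trivializationAt (I := 𝓘(ℝ, E)) hs
  rw [(extChartAt 𝓘(ℝ, E) x).right_inv hy] at this
  simp only [modelWithCornersSelf_coe, Set.range_id, mfderivWithin_univ] at this
  simp only [Function.comp, chartRep, coframe]
  rw [this]

lemma dFun_eq_chart {g : M → ℝ} {x : M}
    (hg : MDifferentiableAt 𝓘(ℝ, E) 𝓘(ℝ, ℝ) g x) :
    dFun g x =
      fderiv ℝ (g ∘ (extChartAt 𝓘(ℝ, E) x).symm) (extChartAt 𝓘(ℝ, E) x x) := by
  simp [dFun, mfderiv, hg, writtenInExtChartAt, fderivWithin_univ]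
  rfl

/-- coordinate expression of a vector field in the chart at x -/
def vecRep (X : ∀ x : M, TangentSpace 𝓘(ℝ, E) x) (x : M) : E → E :=
  mpullback 𝓘(ℝ, E) 𝓘(ℝ, E) (extChartAt 𝓘(ℝ, E) x).symm X

lemma vecRep_diff {X : ∀ x : M, TangentSpace 𝓘(ℝ, E) x} {x : M} (h : SmoothVecAt X x) :
    DifferentiableAt ℝ (vecRep X x) (extChartAt 𝓘(ℝ, E) x x) := by
  have := FiniteDimensional.complete ℝ E
  have := MDifferentiableWithinAt.differentiableWithinAt_mpullbackWithin_vectorField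
    (I := 𝓘(ℝ, E)) (s := Set.univ) (x := x) (V := X)
    (by
      rw [mdifferentiableWithinAt_univ]
      exact ContMDiffAt.mdifferentiableAt h (by simp))
  rw [← differentiableWithinAt_univ]
  simp only [modelWithCornersSelf_coe, Set.range_id, Set.preimage_univ, Set.inter_univ,
    mpullbackWithin_univ] at this
  exact this

lemma apply_smoothAt {θ : ∀ x : M, Covec E x} {X : ∀ x : M, TangentSpace 𝓘(ℝ, E) x} {x : M}
    (hθ : SmoothCovecAt θ x) (hX : SmoothVecAt X x) :
    ContMDiffAt 𝓘(ℝ, E) 𝓘(ℝ, ℝ) ∞ (fun m => (θ m (X m) : ℝ)) x := by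
  have := ContMDiffAt.clm_bundle_apply hθ hX
  rw [contMDiffAt_totalSpace] at this
  exact this.2

lemma vecRep_self (X : ∀ x : M, TangentSpace 𝓘(ℝ, E) x) (x : M) :
    vecRep X x (extChartAt 𝓘(ℝ, E) x x) = X x := by
  have h := mfderivWithin_extChartAt_symm_inverse_apply (I := 𝓘(ℝ, E))
    (X ((extChartAt 𝓘(ℝ, E) x).symm (extChartAt 𝓘(ℝ, E) x x)) : E) (x := x)
  simp only [modelWithCornersSelf_coe, Set.range_id, mfderivWithin_univ] at h
  have h2 : vecRep X x (extChartAt 𝓘(ℝ, E) x x) =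
    X ((extChartAt 𝓘(ℝ, E) x).symm (extChartAt 𝓘(ℝ, E) x x)) := h
  rw [h2]
  have h3 : ∀ y, y = x → (X y : E) = X x := by rintro y rfl; rfl
  exact h3 _ (extChartAt_to_inv x)

lemma vecRep_bracket (X Y : ∀ x : M, TangentSpace 𝓘(ℝ, E) x) (x : M) :
    mlieBracket 𝓘(ℝ, E) X Y x =
      fderiv ℝ (vecRep Y x) (extChartAt 𝓘(ℝ, E) x x) (X x) -
      fderiv ℝ (vecRep X x) (extChartAt 𝓘(ℝ, E) x x) (Y x) := by
  have := FiniteDimensional.complete ℝ E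
  have h := vecRep_self X x
  have h' := vecRep_self Y x
  have h1 : mlieBracket 𝓘(ℝ, E) X Y x =
      lieBracket ℝ (vecRep X x) (vecRep Y x) (extChartAt 𝓘(ℝ, E) x x) := by
    rw [← mlieBracketWithin_univ, mlieBracketWithin_apply, mfderiv_extChartAt_self]
    simp only [modelWithCornersSelf_coe, Set.range_id, Set.preimage_univ, Set.inter_univ,
      mpullbackWithin_univ]
    erw [ContinuousLinearMap.inverse_id, lieBracketWithin_univ]
    rfl
  have h2 : lieBracket ℝ (vecRep X x) (vecRep Y x) (extChartAt 𝓘(ℝ, E) x x) =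
      fderiv ℝ (vecRep Y x) (extChartAt 𝓘(ℝ, E) x x) (vecRep X x (extChartAt 𝓘(ℝ, E) x x)) -
      fderiv ℝ (vecRep X x) (extChartAt 𝓘(ℝ, E) x x) (vecRep Y x (extChartAt 𝓘(ℝ, E) x x)) := rfl
  rw [h, h'] at h2
  exact h1.trans h2

lemma pairing_chart (θ : ∀ x : M, Covec E x) (Z : ∀ x : M, TangentSpace 𝓘(ℝ, E) x) (x : M) :
    ((fun m => (θ m (Z m) : ℝ)) ∘ (extChartAt 𝓘(ℝ, E) x).symm)
      =ᶠ[𝓝 (extChartAt 𝓘(ℝ, E) x x)] fun y => chartRep θ x y (vecRep Z x y) := by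
  have := FiniteDimensional.complete ℝ E
  filter_upwards [target_nhds (E := E) x] with y hy
  have hinv := isInvertible_mfderivWithin_extChartAt_symm (I := 𝓘(ℝ, E)) hy
  simp only [modelWithCornersSelf_coe, Set.range_id, mfderivWithin_univ] at hinv
  have h2 := hinv.self_apply_inverse (Z ((extChartAt 𝓘(ℝ, E) x).symm y))
  exact congrArg (θ ((extChartAt 𝓘(ℝ, E) x).symm y)) h2.symm

lemma chartRep_self (θ : ∀ x : M, Covec E x) (x : M) (v : E) :
    chartRep θ x (extChartAt 𝓘(ℝ, E) x x) v = θ x v := by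
  have h := (pairing_chart θ (fun _ => v) x).self_of_nhds
  have h2 : chartRep θ x (extChartAt 𝓘(ℝ, E) x x) (vecRep (fun _ : M => v) x
    (extChartAt 𝓘(ℝ, E) x x)) = chartRep θ x (extChartAt 𝓘(ℝ, E) x x) v :=
    congrArg _ (vecRep_self (fun _ => v) x)
  have h4 := h2.symm.trans h.symm
  refine h4.trans ?_
  have h3 : ∀ y, y = x → (θ y v : ℝ) = θ x v := by rintro y rfl; rfl
  exact h3 _ (extChartAt_to_inv x)

lemma dFun_pairing {θ : ∀ x : M, Covec E x} {Z : ∀ x : M, TangentSpace 𝓘(ℝ, E) x} {x : M}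
    (hθ : SmoothCovecAt θ x) (hZ : SmoothVecAt Z x) (v : E) :
    dFun (fun m => (θ m (Z m) : ℝ)) x v =
      fderiv ℝ (chartRep θ x) (extChartAt 𝓘(ℝ, E) x x) v (Z x) +
        θ x (fderiv ℝ (vecRep Z x) (extChartAt 𝓘(ℝ, E) x x) v) := by
  have h1 := dFun_eq_chart ((apply_smoothAt hθ hZ).mdifferentiableAt (by simp))
  have h2 := (pairing_chart θ Z x).fderiv_eq (𝕜 := ℝ)
  have h3 := fderiv_clm_apply (c := chartRep θ x) (u := vecRep Z x) ((chartRep_smooth hθ).differentiableAt (by simp)) (vecRep_diff hZ)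
  have h4 : dFun (fun m => (θ m (Z m) : ℝ)) x v =
    fderiv ℝ (fun y => chartRep θ x y (vecRep Z x y)) (extChartAt 𝓘(ℝ, E) x x) v := by
    rw [h1, h2]
    rfl
  have h5 : fderiv ℝ (fun y => chartRep θ x y (vecRep Z x y)) (extChartAt 𝓘(ℝ, E) x x) v =
      chartRep θ x (extChartAt 𝓘(ℝ, E) x x)
        (fderiv ℝ (vecRep Z x) (extChartAt 𝓘(ℝ, E) x x) v) +
      fderiv ℝ (chartRep θ x) (extChartAt 𝓘(ℝ, E) x x) v
        (vecRep Z x (extChartAt 𝓘(ℝ, E) x x)) := by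
    rw [h3]; rfl
  rw [vecRep_self, chartRep_self, add_comm] at h5
  exact h4.trans h5

lemma extDer_apply {θ : ∀ x : M, Covec E x} {X Y : ∀ x : M, TangentSpace 𝓘(ℝ, E) x} {x : M}
    (hθ : SmoothCovecAt θ x) (hX : SmoothVecAt X x) (hY : SmoothVecAt Y x) :
    extDer θ x (X x) (Y x) =
      dFun (fun m => (θ m (Y m) : ℝ)) x (X x) -
      dFun (fun m => (θ m (X m) : ℝ)) x (Y x) -
      θ x (mlieBracket 𝓘(ℝ, E) X Y x) := by
  have h1 := dFun_pairing hθ hX (Y x)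
  have h2 := dFun_pairing hθ hY (X x)
  have h3 : (θ x (mlieBracket 𝓘(ℝ, E) X Y x) : ℝ) =
      θ x (fderiv ℝ (vecRep Y x) (extChartAt 𝓘(ℝ, E) x x) (X x)) -
      θ x (fderiv ℝ (vecRep X x) (extChartAt 𝓘(ℝ, E) x x) (Y x)) := by
    rw [vecRep_bracket]
    exact map_sub (θ x) _ _
  have h0 : extDer θ x (X x) (Y x) =
      fderiv ℝ (chartRep θ x) (extChartAt 𝓘(ℝ, E) x x) (X x) (Y x) -
      fderiv ℝ (chartRep θ x) (extChartAt 𝓘(ℝ, E) x x) (Y x) (X x) := rfl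
  have h4 : ∀ a b c d e f g h : ℝ, e = a - b → f = a + c → g = b + d → h = c - d →
      e = f - g - h := by intros; linarith
  exact h4 _ _ _ _ _ _ _ _ h0 h2 h1 h3

lemma frame_smoothAt (x : M) (v : E) {m : M} (hm : m ∈ (chartAt E x).source) :
    SmoothVecAt (frame x v) m := by
  have h1 := (trivializationAt E (TangentSpace 𝓘(ℝ, E)) x).contMDiffAt_symmL
    (n := ∞) (IB := 𝓘(ℝ, E)) (x := m) (by simpa using hm)
  have h2 : ContMDiffAt 𝓘(ℝ, E) (𝓘(ℝ, E).prod 𝓘(ℝ, E)) ∞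
      (fun m : M => TotalSpace.mk' E (E := Bundle.Trivial M E) m v) m := by
    rw [contMDiffAt_totalSpace]
    exact ⟨contMDiffAt_id, contMDiffAt_const⟩
  exact ContMDiffAt.clm_bundle_apply h1 h2

lemma frame_surj {x m : M} (hm : m ∈ (chartAt E x).source) (w : TangentSpace 𝓘(ℝ, E) m) :
    ∃ v : E, frame x v m = w :=
  ⟨(trivializationAt E (TangentSpace 𝓘(ℝ, E)) x).continuousLinearMapAt ℝ m w,
    (trivializationAt E (TangentSpace 𝓘(ℝ, E)) x).symmL_continuousLinearMapAt
      (by simpa using hm) w⟩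

/-- every tangent vector extends to a vector field, smooth near its base point -/
lemma exists_field (x : M) (w : TangentSpace 𝓘(ℝ, E) x) :
    ∃ Z : ∀ x : M, TangentSpace 𝓘(ℝ, E) x, (∀ᶠ m in 𝓝 x, SmoothVecAt Z m) ∧ Z x = w := by
  obtain ⟨v, hv⟩ := frame_surj (mem_chart_source E x) w
  refine ⟨frame x v, ?_, hv⟩
  filter_upwards [(chartAt E x).open_source.mem_nhds (mem_chart_source E x)] with m hm
  exact frame_smoothAt x v hm

lemma smoothCovecAt_of_frame {θ : ∀ x : M, Covec E x} {x : M}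
    (h : ∀ v : E, ContMDiffAt 𝓘(ℝ, E) 𝓘(ℝ, ℝ) ∞ (fun m => (θ m (frame x v m) : ℝ)) x) :
    SmoothCovecAt θ x := by
  rw [smoothCovecAt_iff]
  let b := Module.finBasis ℝ E
  have : coframe θ x = fun m => ∑ i, (θ m (frame x (b i) m) : ℝ) •
      (LinearMap.toContinuousLinearMap (b.coord i) : E →L[ℝ] ℝ) := by
    funext m
    ext v
    have hv : v = ∑ i, b.repr v i • b i := (b.sum_repr v).symm
    have h1 : coframe θ x m v = ∑ i, b.repr v i • coframe θ x m (b i) := by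
      conv_lhs => rw [hv]
      rw [map_sum]
      simp only [map_smul]
    rw [h1]
    simp only [sum_apply, smul_apply, smul_eq_mul]
    refine Finset.sum_congr rfl fun i _ => ?_
    rw [mul_comm]
    rfl
  rw [this]
  exact ContMDiffAt.sum fun i _ => (h (b i)).smul contMDiffAt_const

lemma dFun_smoothAt {f : M → ℝ} {x : M} (hf : ContMDiffAt 𝓘(ℝ, E) 𝓘(ℝ, ℝ) ∞ f x) :
    SmoothCovecAt (dFun (E := E) f) x := by
  rw [smoothCovecAt_iff]
  have h := hf.mfderiv_const (m := ∞) (by simp)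
  refine h.congr_of_eventuallyEq (Filter.Eventually.of_forall fun m => ?_)
  ext v
  simp [inTangentCoordinates, ContinuousLinearMap.inCoordinates, coframe]
  rfl

lemma extDer_smoothAt {θ : ∀ x : M, Covec E x} {X : ∀ x : M, TangentSpace 𝓘(ℝ, E) x} {x : M}
    (hθ : ∀ᶠ m in 𝓝 x, SmoothCovecAt θ m) (hX : ∀ᶠ m in 𝓝 x, SmoothVecAt X m) :
    SmoothCovecAt (fun m => (extDer θ m (X m) : Covec E m)) x := by
  have := FiniteDimensional.complete ℝ E
  have i2 : IsManifold 𝓘(ℝ, E) (minSmoothness ℝ 2) M := by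
    rw [minSmoothness_of_isRCLikeNormedField]
    exact IsManifold.of_le (n := ∞) (mod_cast le_top : ((2 : ℕ∞) : WithTop ℕ∞) ≤ ∞)
  have i3 : IsManifold 𝓘(ℝ, E) (((⊤ : ℕ∞) : WithTop ℕ∞) + 1) M := by
    rw [show (((⊤ : ℕ∞) : WithTop ℕ∞) + 1) = ∞ from rfl]; infer_instance
  refine smoothCovecAt_of_frame fun v => ?_
  have hF : ∀ᶠ m in 𝓝 x, SmoothVecAt (frame x v) m := by
    filter_upwards [(chartAt E x).open_source.mem_nhds (mem_chart_source E x)] with m hm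
    exact frame_smoothAt x v hm
  have e : (fun m => ((extDer θ m (X m) : Covec E m) (frame x v m) : ℝ)) =ᶠ[𝓝 x] fun m =>
      ((dFun (fun m => (θ m (frame x v m) : ℝ)) m (X m) : ℝ) -
      (dFun (fun m => (θ m (X m) : ℝ)) m (frame x v m) : ℝ)) -
      (θ m (mlieBracket 𝓘(ℝ, E) X (frame x v) m) : ℝ) := by
    filter_upwards [hθ, hX, hF] with m h1 h2 h3
    exact extDer_apply h1 h2 h3
  refine ContMDiffAt.congr_of_eventuallyEq ?_ e
  have hθ0 := hθ.self_of_nhds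
  have hX0 := hX.self_of_nhds
  have hF0 := hF.self_of_nhds
  refine ContMDiffAt.sub (ContMDiffAt.sub ?_ ?_) ?_
  · exact apply_smoothAt (dFun_smoothAt (apply_smoothAt hθ0 hF0)) hX0
  · exact apply_smoothAt (dFun_smoothAt (apply_smoothAt hθ0 hX0)) hF0
  · refine apply_smoothAt hθ0 ?_
    exact ContMDiffAt.mlieBracket_vectorField (m := ⊤) (n := ⊤) hX0 hF0 (by simp)

lemma bracket_smoothAt {X Y : ∀ x : M, TangentSpace 𝓘(ℝ, E) x} {x : M}
    (hX : SmoothVecAt X x) (hY : SmoothVecAt Y x) :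
    SmoothVecAt (mlieBracket 𝓘(ℝ, E) X Y) x := by
  have := FiniteDimensional.complete ℝ E
  have i2 : IsManifold 𝓘(ℝ, E) (minSmoothness ℝ 2) M := by
    rw [minSmoothness_of_isRCLikeNormedField]
    exact IsManifold.of_le (n := ∞) (mod_cast le_top : ((2 : ℕ∞) : WithTop ℕ∞) ≤ ∞)
  have i3 : IsManifold 𝓘(ℝ, E) (((⊤ : ℕ∞) : WithTop ℕ∞) + 1) M := by
    rw [show (((⊤ : ℕ∞) : WithTop ℕ∞) + 1) = ∞ from rfl]; infer_instance
  exact ContMDiffAt.mlieBracket_vectorField (m := ⊤) (n := ⊤) hX hY (by simp)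

lemma covec_ext {x : M} {a b : Covec E x}
    (h : ∀ Z : ∀ x : M, TangentSpace 𝓘(ℝ, E) x, (∀ᶠ m in 𝓝 x, SmoothVecAt Z m) →
      (a (Z x) : ℝ) = b (Z x)) : a = b := by
  refine ContinuousLinearMap.ext fun w => ?_
  obtain ⟨Z, hZ, rfl⟩ := exists_field x w
  exact h Z hZ

/-- `ι_X dθ` -/
def iotaD (X : ∀ x : M, TangentSpace 𝓘(ℝ, E) x) (θ : ∀ x : M, Covec E x) (x : M) : Covec E x :=
  extDer θ x (X x)

/-- The Lie derivative `L_X θ = ι_X dθ + d(ι_X θ)` -/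
def lieDer (X : ∀ x : M, TangentSpace 𝓘(ℝ, E) x) (θ : ∀ x : M, Covec E x) (x : M) : Covec E x :=
  iotaD X θ x + dFun (fun m => (θ m (X m) : ℝ)) x

lemma lieDer_apply {θ : ∀ x : M, Covec E x} {X Z : ∀ x : M, TangentSpace 𝓘(ℝ, E) x} {x : M}
    (hθ : SmoothCovecAt θ x) (hX : SmoothVecAt X x) (hZ : SmoothVecAt Z x) :
    (lieDer X θ x (Z x) : ℝ) =
      (dFun (fun m => (θ m (Z m) : ℝ)) x (X x) : ℝ) - (θ x (mlieBracket 𝓘(ℝ, E) X Z x) : ℝ) := by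
  have h := extDer_apply hθ hX hZ
  have h2 : (lieDer X θ x (Z x) : ℝ) = extDer θ x (X x) (Z x) +
    (dFun (fun m => (θ m (X m) : ℝ)) x (Z x) : ℝ) := rfl
  have h4 : ∀ a b c d e : ℝ, a = b - c - d → e = a + c → e = b - d := by intros; linarith
  exact h4 _ _ _ _ _ h h2

lemma lieDer_smoothAt {θ : ∀ x : M, Covec E x} {X : ∀ x : M, TangentSpace 𝓘(ℝ, E) x} {x : M}
    (hθ : ∀ᶠ m in 𝓝 x, SmoothCovecAt θ m) (hX : ∀ᶠ m in 𝓝 x, SmoothVecAt X m) :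
    SmoothCovecAt (lieDer X θ) x := by
  have h1 := extDer_smoothAt hθ hX
  have h2 := dFun_smoothAt (apply_smoothAt hθ.self_of_nhds hX.self_of_nhds)
  exact ContMDiffAt.add_section h1 h2

lemma dFun_add {f g : M → ℝ} {x : M} (hf : ContMDiffAt 𝓘(ℝ, E) 𝓘(ℝ, ℝ) ∞ f x)
    (hg : ContMDiffAt 𝓘(ℝ, E) 𝓘(ℝ, ℝ) ∞ g x) :
    dFun (E := E) (fun m => f m + g m) x = dFun f x + dFun g x :=
  mfderiv_add (hf.mdifferentiableAt (by simp)) (hg.mdifferentiableAt (by simp))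

lemma dFun_smul {f : M → ℝ} {x : M} (r : ℝ) (hf : ContMDiffAt 𝓘(ℝ, E) 𝓘(ℝ, ℝ) ∞ f x) :
    dFun (E := E) (fun m => r * f m) x = r • dFun f x :=
  const_smul_mfderiv (hf.mdifferentiableAt (by simp)) r

lemma dFun_congr {f g : M → ℝ} {x : M} (h : f =ᶠ[𝓝 x] g) :
    dFun (E := E) f x = dFun g x := h.mfderiv_eq

lemma extDer_congr {θ θ' : ∀ x : M, Covec E x} {x : M} (h : ∀ᶠ m in 𝓝 x, θ m = θ' m) :
    extDer θ x = extDer θ' x := by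
  have : chartRep θ x =ᶠ[𝓝 (extChartAt 𝓘(ℝ, E) x x)] chartRep θ' x := by
    have hc : ContinuousAt (extChartAt 𝓘(ℝ, E) x).symm (extChartAt 𝓘(ℝ, E) x x) :=
      continuousAt_extChartAt_symm x
    have h' : ∀ᶠ m in 𝓝 ((extChartAt 𝓘(ℝ, E) x).symm (extChartAt 𝓘(ℝ, E) x x)), θ m = θ' m := by
      rw [extChartAt_to_inv]; exact h
    filter_upwards [hc.eventually h'] with y hy
    simp only [chartRep]
    rw [hy]
  unfold extDer
  rw [this.fderiv_eq]

lemma lieDer_congr {X : ∀ x : M, TangentSpace 𝓘(ℝ, E) x} {θ θ' : ∀ x : M, Covec E x} {x : M}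
    (h : ∀ᶠ m in 𝓝 x, θ m = θ' m) : lieDer X θ x = lieDer X θ' x := by
  unfold lieDer iotaD
  rw [extDer_congr h, dFun_congr (f := fun m => (θ m (X m) : ℝ)) (g := fun m => (θ' m (X m) : ℝ))]
  filter_upwards [h] with m hm
  rw [hm]

lemma extDer_dFun {f : M → ℝ} {x : M} (hf : ContMDiffAt 𝓘(ℝ, E) 𝓘(ℝ, ℝ) ∞ f x) :
    extDer (dFun (E := E) f) x = 0 := by
  have h0 : ContDiffAt ℝ ∞ (f ∘ (extChartAt 𝓘(ℝ, E) x).symm) (extChartAt 𝓘(ℝ, E) x x) := by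
    rw [← contMDiffAt_iff_contDiffAt]
    have h2 : ContMDiffAt 𝓘(ℝ, E) 𝓘(ℝ, E) ∞ (extChartAt 𝓘(ℝ, E) x).symm
        (extChartAt 𝓘(ℝ, E) x x) :=
      (contMDiffOn_extChartAt_symm x).contMDiffAt (target_nhds x)
    exact ContMDiffAt.comp (extChartAt 𝓘(ℝ, E) x x) (by rwa [extChartAt_to_inv]) h2
  have h1 : chartRep (dFun (E := E) f) x =ᶠ[𝓝 (extChartAt 𝓘(ℝ, E) x x)]
      fderiv ℝ (f ∘ (extChartAt 𝓘(ℝ, E) x).symm) := by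
    have hfe : ∀ᶠ m in 𝓝 x, ContMDiffAt 𝓘(ℝ, E) 𝓘(ℝ, ℝ) 1 f m :=
      (contMDiffAt_iff_contMDiffAt_nhds (by simp)).1 (ContMDiffAt.of_le hf (mod_cast le_top : ((1 : ℕ∞) : WithTop ℕ∞) ≤ ∞))
    have hc : ContinuousAt (extChartAt 𝓘(ℝ, E) x).symm (extChartAt 𝓘(ℝ, E) x x) :=
      continuousAt_extChartAt_symm x
    have h' : ∀ᶠ m in 𝓝 ((extChartAt 𝓘(ℝ, E) x).symm (extChartAt 𝓘(ℝ, E) x x)),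
        ContMDiffAt 𝓘(ℝ, E) 𝓘(ℝ, ℝ) 1 f m := by
      rw [extChartAt_to_inv]; exact hfe
    filter_upwards [hc.eventually h', eventually_mem_nhds_iff.2 (target_nhds (E := E) x)]
      with y hy hy2
    have h2 : ContMDiffAt 𝓘(ℝ, E) 𝓘(ℝ, E) ∞ (extChartAt 𝓘(ℝ, E) x).symm y :=
      (contMDiffOn_extChartAt_symm x).contMDiffAt hy2
    have h3 := mfderiv_comp y (hy.mdifferentiableAt (by simp)) (h2.mdifferentiableAt (by simp))
    rw [mfderiv_eq_fderiv] at h3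
    exact h3.symm
  have h2 := h0.isSymmSndFDerivAt
    (by rw [minSmoothness_of_isRCLikeNormedField]; exact (mod_cast le_top : ((2 : ℕ∞) : WithTop ℕ∞) ≤ ∞))
  unfold extDer
  rw [h1.fderiv_eq]
  ext v w
  have := h2 v w
  simp only [sub_apply, ContinuousLinearMap.flip_apply, zero_apply]
  rw [this, sub_self]

lemma lieDer_dFun {X : ∀ x : M, TangentSpace 𝓘(ℝ, E) x} {f : M → ℝ} {x : M}
    (hf : ContMDiffAt 𝓘(ℝ, E) 𝓘(ℝ, ℝ) ∞ f x) :
    lieDer X (dFun f) x = dFun (fun m => (dFun f m (X m) : ℝ)) x := by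
  unfold lieDer iotaD
  rw [extDer_dFun hf]
  exact zero_add _

lemma dFun_bracket {X Y : ∀ x : M, TangentSpace 𝓘(ℝ, E) x} {f : M → ℝ} {x : M}
    (hX : SmoothVecAt X x) (hY : SmoothVecAt Y x)
    (hf : ContMDiffAt 𝓘(ℝ, E) 𝓘(ℝ, ℝ) ∞ f x) :
    (dFun f x (mlieBracket 𝓘(ℝ, E) X Y x) : ℝ) =
      (dFun (fun m => (dFun f m (Y m) : ℝ)) x (X x) : ℝ) -
      (dFun (fun m => (dFun f m (X m) : ℝ)) x (Y x) : ℝ) := by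
  have h := extDer_apply (dFun_smoothAt hf) hX hY
  rw [extDer_dFun hf] at h
  have h4 : ∀ a b c : ℝ, 0 = a - b - c → c = a - b := by intros; linarith
  exact h4 _ _ _ h

lemma lieDer_add {X : ∀ x : M, TangentSpace 𝓘(ℝ, E) x} {θ θ' : ∀ x : M, Covec E x} {x : M}
    (hX : ∀ᶠ m in 𝓝 x, SmoothVecAt X m) (hθ : SmoothCovecAt θ x) (hθ' : SmoothCovecAt θ' x) :
    lieDer X (fun m => θ m + θ' m) x = lieDer X θ x + lieDer X θ' x := by
  refine covec_ext fun Z hZ => ?_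
  have hX := hX.self_of_nhds
  have hZ := hZ.self_of_nhds
  have hs : SmoothCovecAt (fun m => θ m + θ' m) x := ContMDiffAt.add_section hθ hθ'
  have h1 := lieDer_apply hs hX hZ
  have h2 := lieDer_apply hθ hX hZ
  have h3 := lieDer_apply hθ' hX hZ
  have h4 := congrArg (fun a : Covec E x => (a (X x) : ℝ))
    (dFun_add (apply_smoothAt hθ hZ) (apply_smoothAt hθ' hZ))
  have key : ∀ a b c d e f g h i : ℝ, a = d - (h + i) → b = f - h → c = g - i → d = f + g →
    a = b + c := by intros; linarith
  exact key _ _ _ _ 0 _ _ _ _ h1 h2 h3 h4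

lemma lieDer_smul {X : ∀ x : M, TangentSpace 𝓘(ℝ, E) x} {θ : ∀ x : M, Covec E x} {x : M}
    (r : ℝ) (hX : ∀ᶠ m in 𝓝 x, SmoothVecAt X m) (hθ : SmoothCovecAt θ x) :
    lieDer X (fun m => r • θ m) x = r • lieDer X θ x := by
  refine covec_ext fun Z hZ => ?_
  have hX := hX.self_of_nhds
  have hZ := hZ.self_of_nhds
  have hs : SmoothCovecAt (fun m => r • θ m) x := ContMDiffAt.const_smul_section hθ
  have h1 := lieDer_apply hs hX hZ
  have h2 := lieDer_apply hθ hX hZ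
  have h4 := congrArg (fun a : Covec E x => (a (X x) : ℝ)) (dFun_smul r (apply_smoothAt hθ hZ))
  have key : ∀ a b d f h : ℝ, a = d - r * h → b = f - h → d = r * f → a = r * b := by
    intros; subst_vars; ring
  exact key _ _ _ _ _ h1 h2 h4

lemma lieDer_bracket {X Y : ∀ x : M, TangentSpace 𝓘(ℝ, E) x} {θ : ∀ x : M, Covec E x} {x : M}
    (hX : ∀ᶠ m in 𝓝 x, SmoothVecAt X m) (hY : ∀ᶠ m in 𝓝 x, SmoothVecAt Y m)
    (hθ : ∀ᶠ m in 𝓝 x, SmoothCovecAt θ m) :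
    lieDer (mlieBracket 𝓘(ℝ, E) X Y) θ x =
      lieDer X (lieDer Y θ) x - lieDer Y (lieDer X θ) x := by
  have := FiniteDimensional.complete ℝ E
  refine covec_ext fun Z hZ => ?_
  have i3 : IsManifold 𝓘(ℝ, E) (minSmoothness ℝ 3) M := by
    rw [minSmoothness_of_isRCLikeNormedField]
    exact IsManifold.of_le (n := ∞) (mod_cast le_top : ((3 : ℕ∞) : WithTop ℕ∞) ≤ ∞)
  have hX0 := hX.self_of_nhds
  have hY0 := hY.self_of_nhds
  have hZ0 := hZ.self_of_nhds
  have hθ0 := hθ.self_of_nhds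
  have half : ∀ X Y : ∀ x : M, TangentSpace 𝓘(ℝ, E) x, (∀ᶠ m in 𝓝 x, SmoothVecAt X m) →
      (∀ᶠ m in 𝓝 x, SmoothVecAt Y m) → (lieDer X (lieDer Y θ) x (Z x) : ℝ) =
      (dFun (fun m => (dFun (fun m => (θ m (Z m) : ℝ)) m (Y m) : ℝ)) x (X x) : ℝ)
      - (dFun (fun m => (θ m (mlieBracket 𝓘(ℝ, E) Y Z m) : ℝ)) x (X x) : ℝ)
      - (dFun (fun m => (θ m (mlieBracket 𝓘(ℝ, E) X Z m) : ℝ)) x (Y x) : ℝ)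
      + (θ x (mlieBracket 𝓘(ℝ, E) Y (mlieBracket 𝓘(ℝ, E) X Z) x) : ℝ) := by
    intro X Y hX hY
    have hX0 := hX.self_of_nhds
    have hY0 := hY.self_of_nhds
    have h1 := lieDer_apply (lieDer_smoothAt hθ hY) hX0 hZ0
    have h2 := lieDer_apply hθ0 hY0 (bracket_smoothAt hX0 hZ0)
    have h3 : (fun m => (lieDer Y θ m (Z m) : ℝ)) =ᶠ[𝓝 x] fun m =>
        (dFun (fun m => (θ m (Z m) : ℝ)) m (Y m) : ℝ) +
        (-1) * (θ m (mlieBracket 𝓘(ℝ, E) Y Z m) : ℝ) := by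
      filter_upwards [hθ, hY, hZ] with m a b c
      rw [lieDer_apply a b c]
      ring
    have s1 := apply_smoothAt (dFun_smoothAt (apply_smoothAt hθ0 hZ0)) hY0
    have s2 := apply_smoothAt hθ0 (bracket_smoothAt hY0 hZ0)
    have h4 := congrArg (fun a : Covec E x => (a (X x) : ℝ))
      ((dFun_congr h3).trans ((dFun_add s1 (contMDiffAt_const.mul s2)).trans
        (congrArg _ (dFun_smul (-1) s2))))
    have key : ∀ a b c d e f g : ℝ, a = b - c → c = d - e → b = f + (-1) * g →
      a = f - g - d + e := by intros; subst_vars; ring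
    exact key _ _ _ _ _ _ _ h1 h2 h4
  have hXY : ∀ᶠ m in 𝓝 x, SmoothVecAt (mlieBracket 𝓘(ℝ, E) X Y) m := by
    filter_upwards [hX, hY] with m a b
    exact bracket_smoothAt a b
  have h1 := half X Y hX hY
  have h2 := half Y X hY hX
  have h3 := lieDer_apply hθ0 hXY.self_of_nhds hZ0
  have h4 := dFun_bracket hX0 hY0 (apply_smoothAt hθ0 hZ0)
  have i : ∀ {V : ∀ x : M, TangentSpace 𝓘(ℝ, E) x}, SmoothVecAt V x →
      ContMDiffAt 𝓘(ℝ, E) (𝓘(ℝ, E).prod 𝓘(ℝ, E)) (minSmoothness ℝ 2)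
        (fun x => TotalSpace.mk' E x (V x)) x := by
    intro V hV
    rw [minSmoothness_of_isRCLikeNormedField]
    exact ContMDiffAt.of_le hV (mod_cast le_top : ((2 : ℕ∞) : WithTop ℕ∞) ≤ ∞)
  have h5 : (θ x (mlieBracket 𝓘(ℝ, E) X (mlieBracket 𝓘(ℝ, E) Y Z) x) : ℝ) =
      (θ x (mlieBracket 𝓘(ℝ, E) (mlieBracket 𝓘(ℝ, E) X Y) Z x) : ℝ) +
      (θ x (mlieBracket 𝓘(ℝ, E) Y (mlieBracket 𝓘(ℝ, E) X Z) x) : ℝ) := by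
    rw [leibniz_identity_mlieBracket_apply (i hX0) (i hY0) (i hZ0)]
    exact map_add (θ x) _ _
  have key : ∀ l1 l2 l a b c d p q j m r n : ℝ, l1 = a - b - c + p → l2 = d - c - b + q →
      l = r - j → r = a - d → q = j + p → l = l1 - l2 := by intros; subst_vars; ring
  exact key _ _ _ _ _ _ _ _ _ _ 0 _ 0 h1 h2 h3 h4 h5

end Calculus

/-! ### Smooth functions and 1-forms on open sets -/

section Local

open TopologicalSpace (Opens)

variable (E : Type*) [NormedAddCommGroup E] [NormedSpace ℝ E] [FiniteDimensional ℝ E]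
  {M : Type*} [TopologicalSpace M] [ChartedSpace E M] [IsManifold 𝓘(ℝ, E) ∞ M]

/-- `C^∞(U)` for an open subset `U` of `M`. A smooth function on `U` is stored as the function
on `M` that extends it by zero, so that it is determined by its values on `U`; smoothness is only
required on `U`. -/
def fnSubmodule (U : Opens M) : Submodule ℝ (M → ℝ) where
  carrier := {f | (∀ x ∈ U, ContMDiffAt 𝓘(ℝ, E) 𝓘(ℝ, ℝ) ∞ f x) ∧ ∀ x ∉ U, f x = 0}
  add_mem' := fun {f g} hf hg => ⟨fun x hx => (hf.1 x hx).add (hg.1 x hx),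
    fun x hx => by simp [hf.2 x hx, hg.2 x hx]⟩
  zero_mem' := ⟨fun _ _ => contMDiffAt_const, fun _ _ => rfl⟩
  smul_mem' := fun r f hf => ⟨fun x hx => contMDiffAt_const.mul (hf.1 x hx),
    fun x hx => by simp [hf.2 x hx]⟩

/-- `Ω¹(U)` for an open subset `U` of `M`: smooth sections over `U` of the cotangent bundle,
again stored as their extensions by zero. -/
def formSubmodule (U : Opens M) : Submodule ℝ (∀ x : M, Covec E x) where
  carrier := {θ | (∀ x ∈ U, SmoothCovecAt θ x) ∧ ∀ x ∉ U, θ x = 0}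
  add_mem' := fun {f g} hf hg => ⟨fun x hx => ContMDiffAt.add_section (hf.1 x hx) (hg.1 x hx),
    fun x hx => by simp [hf.2 x hx, hg.2 x hx]⟩
  zero_mem' := ⟨fun _ _ => contMDiff_zeroSection ℝ (fun x : M => Covec E x) _, fun _ _ => rfl⟩
  smul_mem' := fun r f hf => ⟨fun x hx => ContMDiffAt.const_smul_section (hf.1 x hx),
    fun x hx => by simp [hf.2 x hx]⟩

/-- The real vector space `C^∞(U)`. -/
def Fn (U : Opens M) : Type _ := fnSubmodule E U

/-- The real vector space `Ω¹(U)`. -/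
def Form (U : Opens M) : Type _ := formSubmodule E U

instance (U : Opens M) : AddCommGroup (Fn E U) := inferInstanceAs (AddCommGroup (fnSubmodule E U))
instance (U : Opens M) : Module ℝ (Fn E U) := inferInstanceAs (Module ℝ (fnSubmodule E U))
instance (U : Opens M) : AddCommGroup (Form E U) :=
  inferInstanceAs (AddCommGroup (formSubmodule E U))
instance (U : Opens M) : Module ℝ (Form E U) := inferInstanceAs (Module ℝ (formSubmodule E U))

variable (M) in
/-- `𝔛(M)`: smooth vector fields on `M`. -/
abbrev VF : Type _ := ContMDiffSection 𝓘(ℝ, E) E ∞ (TangentSpace 𝓘(ℝ, E) : M → Type _)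

variable {E}

lemma vf_smoothAt (X : VF E M) (x : M) : SmoothVecAt (fun m => X m) x := X.contMDiff x

lemma vf_ev (X : VF E M) (x : M) : ∀ᶠ m in 𝓝 x, SmoothVecAt (fun m => X m) m :=
  Filter.Eventually.of_forall (vf_smoothAt X)

lemma form_ev {U : Opens M} (θ : Form E U) {x : M} (hx : x ∈ U) :
    ∀ᶠ m in 𝓝 x, SmoothCovecAt θ.1 m := by
  filter_upwards [U.isOpen.mem_nhds hx] with m hm
  exact θ.2.1 m hm

open Classical in
/-- Set a form to zero outside `U`. -/
def cutForm (U : Opens M) (θ : ∀ x : M, Covec E x) (x : M) : Covec E x := if x ∈ U then θ x else 0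

open Classical in
/-- Set a function to zero outside `U`. -/
def cutFn (U : Opens M) (f : M → ℝ) (x : M) : ℝ := if x ∈ U then f x else 0

lemma cutForm_of_mem {U : Opens M} {θ : ∀ x : M, Covec E x} {x : M} (hx : x ∈ U) :
    cutForm U θ x = θ x := if_pos hx

lemma cutFn_of_mem {U : Opens M} {f : M → ℝ} {x : M} (hx : x ∈ U) :
    cutFn U f x = f x := if_pos hx

/-- The 1-form on `U` given by a pointwise formula that is smooth on `U`. -/
def formOf (U : Opens M) (θ : ∀ x : M, Covec E x) (h : ∀ x ∈ U, SmoothCovecAt θ x) : Form E U :=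
  ⟨cutForm U θ, fun x hx => by
    refine ContMDiffAt.congr_of_eventuallyEq (h x hx) ?_
    filter_upwards [U.isOpen.mem_nhds hx] with m hm
    rw [cutForm_of_mem hm], fun _ hx => if_neg hx⟩

/-- The function on `U` given by a pointwise formula that is smooth on `U`. -/
def fnOf (U : Opens M) (f : M → ℝ) (h : ∀ x ∈ U, ContMDiffAt 𝓘(ℝ, E) 𝓘(ℝ, ℝ) ∞ f x) : Fn E U :=
  ⟨cutFn U f, fun x hx => by
    refine ContMDiffAt.congr_of_eventuallyEq (h x hx) ?_
    filter_upwards [U.isOpen.mem_nhds hx] with m hm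
    rw [cutFn_of_mem hm], fun _ hx => if_neg hx⟩

/-- Restriction of functions to a smaller open set. -/
def restr {U V : Opens M} (h : V ≤ U) (f : Fn E U) : Fn E V :=
  fnOf V f.1 fun x hx => f.2.1 x (h hx)

/-- The differential `d : C^∞(U) → Ω¹(U)`. -/
def dif {U : Opens M} (f : Fn E U) : Form E U :=
  formOf U (dFun f.1) fun x hx => dFun_smoothAt (f.2.1 x hx)

/-- Contraction `ι_X θ ∈ C^∞(U)` of a 1-form on `U` with a vector field. -/
def contract (X : VF E M) {U : Opens M} (θ : Form E U) : Fn E U :=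
  ⟨fun x => (θ.1 x (X x) : ℝ), fun x hx => apply_smoothAt (θ.2.1 x hx) (vf_smoothAt X x),
    fun x hx => congrArg (fun a : Covec E x => (a (X x) : ℝ)) (θ.2.2 x hx)⟩

/-- The derivative `X(f) = L_X f = ι_X df` of a function on `U` along a vector field. -/
def act (X : VF E M) {U : Opens M} (f : Fn E U) : Fn E U := contract X (dif f)

/-- The 1-form `ι_X dθ` on `U`. -/
def contractD (X : VF E M) {U : Opens M} (θ : Form E U) : Form E U :=
  formOf U (iotaD (fun m => X m) θ.1) fun x hx => extDer_smoothAt (form_ev θ hx) (vf_ev X x)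

/-- The Lie derivative `L_X θ = ι_X dθ + d(ι_X θ)` of a 1-form on `U`. -/
def lie (X : VF E M) {U : Opens M} (θ : Form E U) : Form E U := contractD X θ + dif (contract X θ)

/-- The Lie bracket of vector fields. -/
def bracket (X Y : VF E M) : VF E M :=
  ⟨mlieBracket 𝓘(ℝ, E) (fun m => X m) (fun m => Y m),
    fun x => bracket_smoothAt (vf_smoothAt X x) (vf_smoothAt Y x)⟩

lemma lie_val (X : VF E M) {U : Opens M} (θ : Form E U) {x : M} (hx : x ∈ U) :
    (lie X θ).1 x = lieDer (fun m => X m) θ.1 x :=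
  congrArg₂ (· + ·) (cutForm_of_mem hx) (cutForm_of_mem hx)

lemma d_val {U : Opens M} (f : Fn E U) {x : M} (hx : x ∈ U) : (dif f).1 x = dFun f.1 x :=
  cutForm_of_mem hx

lemma res_val {U V : Opens M} (h : V ≤ U) (f : Fn E U) {x : M} (hx : x ∈ V) :
    (restr h f).1 x = f.1 x := cutFn_of_mem hx

lemma d_add {U : Opens M} (f g : Fn E U) {x : M} : (dif (f + g)).1 x = (dif f).1 x + (dif g).1 x := by
  by_cases hx : x ∈ U
  · rw [d_val _ hx, d_val _ hx, d_val _ hx]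
    exact dFun_add (f.2.1 x hx) (g.2.1 x hx)
  · rw [(dif (f + g)).2.2 x hx, (dif f).2.2 x hx, (dif g).2.2 x hx, add_zero]

lemma d_smul {U : Opens M} (r : ℝ) (f : Fn E U) {x : M} : (dif (r • f)).1 x = r • (dif f).1 x := by
  by_cases hx : x ∈ U
  · rw [d_val _ hx, d_val _ hx]
    exact dFun_smul r (f.2.1 x hx)
  · rw [(dif (r • f)).2.2 x hx, (dif f).2.2 x hx, smul_zero]

lemma contractD_add_left (X Y : VF E M) {U : Opens M} (θ : Form E U) {x : M} :
    (contractD (X + Y) θ).1 x = (contractD X θ).1 x + (contractD Y θ).1 x := by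
  by_cases hx : x ∈ U
  · refine (cutForm_of_mem hx).trans (Eq.trans ?_
      (congrArg₂ (· + ·) (cutForm_of_mem hx).symm (cutForm_of_mem hx).symm))
    exact map_add (extDer θ.1 x) (X x) (Y x)
  · rw [(contractD (X + Y) θ).2.2 x hx, (contractD X θ).2.2 x hx, (contractD Y θ).2.2 x hx,
      add_zero]

lemma contractD_smul_left (r : ℝ) (X : VF E M) {U : Opens M} (θ : Form E U) {x : M} :
    (contractD (r • X) θ).1 x = r • (contractD X θ).1 x := by
  by_cases hx : x ∈ U
  · refine (cutForm_of_mem hx).trans (Eq.trans ?_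
      (congrArg (r • ·) (cutForm_of_mem hx).symm))
    exact map_smul (extDer θ.1 x) r (X x)
  · rw [(contractD (r • X) θ).2.2 x hx, (contractD X θ).2.2 x hx, smul_zero]

lemma contract_add_left (X Y : VF E M) {U : Opens M} (θ : Form E U) :
    contract (X + Y) θ = contract X θ + contract Y θ := by
  exact Subtype.ext (funext fun x => map_add (θ.1 x) (X x) (Y x))

lemma contract_smul_left (r : ℝ) (X : VF E M) {U : Opens M} (θ : Form E U) :
    contract (r • X) θ = r • contract X θ := by
  exact Subtype.ext (funext fun x => map_smul (θ.1 x) r (X x))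

lemma lie_add_left (X Y : VF E M) {U : Opens M} (θ : Form E U) {x : M} :
    (lie (X + Y) θ).1 x = (lie X θ).1 x + (lie Y θ).1 x := by
  have h1 := contractD_add_left X Y θ (x := x)
  have h2 := d_add (contract X θ) (contract Y θ) (x := x)
  rw [← contract_add_left] at h2
  have h3 : ∀ a b c d e f : Covec E x, a = b + c → d = e + f → a + d = (b + e) + (c + f) := by
    intros; subst_vars; abel
  exact h3 _ _ _ _ _ _ h1 h2

lemma lie_smul_left (r : ℝ) (X : VF E M) {U : Opens M} (θ : Form E U) {x : M} :
    (lie (r • X) θ).1 x = r • (lie X θ).1 x := by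
  have h1 := contractD_smul_left r X θ (x := x)
  have h2 := d_smul r (contract X θ) (x := x)
  rw [← contract_smul_left] at h2
  have h3 : ∀ a b d e : Covec E x, a = r • b → d = r • e → a + d = r • (b + e) := by
    intros; subst_vars; rw [smul_add]
  exact h3 _ _ _ _ h1 h2

lemma lie_bracket (X Y : VF E M) {U : Opens M} (θ : Form E U) {x : M} (hx : x ∈ U) :
    (lie (bracket X Y) θ).1 x = (lie X (lie Y θ)).1 x - (lie Y (lie X θ)).1 x := by
  rw [lie_val _ _ hx, lie_val _ _ hx, lie_val _ _ hx]
  have h : ∀ Z W : VF E M, lieDer (fun m => W m) (lie Z θ).1 x =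
      lieDer (fun m => W m) (lieDer (fun m => Z m) θ.1) x := by
    intro Z W
    refine lieDer_congr ?_
    filter_upwards [U.isOpen.mem_nhds hx] with m hm
    exact lie_val Z θ hm
  rw [h, h]
  exact lieDer_bracket (vf_ev X x) (vf_ev Y x) (form_ev θ hx)

lemma act_val (X : VF E M) {U : Opens M} (f : Fn E U) {x : M} (hx : x ∈ U) :
    (act X f).1 x = dFun f.1 x (X x) :=
  congrArg (fun a : Covec E x => (a (X x) : ℝ)) (d_val f hx)

/-- `L_X d = d L_X` on functions. -/
lemma lie_d (X : VF E M) {U : Opens M} (f : Fn E U) {x : M} (hx : x ∈ U) :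
    (lie X (dif f)).1 x = (dif (act X f)).1 x := by
  rw [lie_val _ _ hx, d_val _ hx]
  have h1 : ∀ᶠ m in 𝓝 x, (dif f).1 m = dFun f.1 m := by
    filter_upwards [U.isOpen.mem_nhds hx] with m hm
    exact d_val f hm
  rw [lieDer_congr h1, lieDer_dFun (f.2.1 x hx)]
  refine dFun_congr ?_
  filter_upwards [U.isOpen.mem_nhds hx] with m hm
  exact (act_val X f hm).symm

/-- `[X,Y](f) = X(Y(f)) - Y(X(f))`. -/
lemma act_bracket (X Y : VF E M) {U : Opens M} (f : Fn E U) {x : M} (hx : x ∈ U) :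
    (act (bracket X Y) f).1 x = (act X (act Y f)).1 x - (act Y (act X f)).1 x := by
  rw [act_val _ _ hx, act_val _ _ hx, act_val _ _ hx]
  have h : ∀ Z : VF E M, dFun (E := E) (act Z f).1 x =
      dFun (fun m => (dFun f.1 m (Z m) : ℝ)) x := by
    intro Z
    refine dFun_congr ?_
    filter_upwards [U.isOpen.mem_nhds hx] with m hm
    exact act_val Z f hm
  rw [h, h]
  exact dFun_bracket (vf_smoothAt X x) (vf_smoothAt Y x) (f.2.1 x hx)

lemma act_congr (X : VF E M) {U V : Opens M} (f : Fn E U) (g : Fn E V) {W : Opens M}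
    (hU : W ≤ U) (hV : W ≤ V) (h : ∀ x ∈ W, f.1 x = g.1 x) {x : M} (hx : x ∈ W) :
    (act X f).1 x = (act X g).1 x := by
  rw [act_val _ _ (hU hx), act_val _ _ (hV hx), dFun_congr]
  filter_upwards [W.isOpen.mem_nhds hx] with m hm
  exact h m hm

end Local

/-! ### Lie 2-algebras -/

section LieTwo

/-- The operations of a (semistrict) Lie 2-algebra on a 2-term complex `W → V`: the differential,
the binary bracket on `V`, the action bracket `[v, w]` of `V` on `W` (with `[w, v] := -[v, w]`) and
the ternary bracket. The laws are in `LieTwo.IsLie`. -/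
structure LieTwo (V W : Type*) where
  del : W → V
  br : V → V → V
  brW : V → W → W
  ter : V → V → V → W

variable {V W V' W' : Type*} [AddCommGroup V] [Module ℝ V] [AddCommGroup W] [Module ℝ W]
  [AddCommGroup V'] [Module ℝ V'] [AddCommGroup W'] [Module ℝ W']

/-- The laws of a Lie 2-algebra over `ℝ`, i.e. of an L-infinity algebra concentrated in two
degrees. The sign of the ternary bracket is normalised so that the Jacobiator
`[[x,y],z] + [[y,z],x] + [[z,x],y]` equals `+ del (ter x y z)`. -/
structure LieTwo.IsLie (L : LieTwo V W) : Prop where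
  del_lin : IsLinearMap ℝ L.del
  br_lin : ∀ x, IsLinearMap ℝ (L.br x)
  br_skew : ∀ x y, L.br x y = -L.br y x
  brW_lin_left : ∀ h, IsLinearMap ℝ (fun x => L.brW x h)
  brW_lin_right : ∀ x, IsLinearMap ℝ (L.brW x)
  ter_lin : ∀ x y, IsLinearMap ℝ (L.ter x y)
  ter_skew₁ : ∀ x y z, L.ter x y z = -L.ter y x z
  ter_skew₂ : ∀ x y z, L.ter x y z = -L.ter x z y
  del_brW : ∀ x h, L.del (L.brW x h) = L.br x (L.del h)
  brW_del : ∀ h k, L.brW (L.del h) k = -L.brW (L.del k) h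
  jacobi : ∀ x y z, L.br (L.br x y) z + L.br (L.br y z) x + L.br (L.br z x) y = L.del (L.ter x y z)
  jacobiW : ∀ x y h, L.brW (L.br x y) h - L.brW x (L.brW y h) + L.brW y (L.brW x h) =
    L.ter x y (L.del h)
  coherence : ∀ x y z w,
    L.brW x (L.ter y z w) - L.brW y (L.ter x z w) + L.brW z (L.ter x y w) - L.brW w (L.ter x y z) =
      L.ter (L.br x y) z w - L.ter (L.br x z) y w + L.ter (L.br x w) y z
        + L.ter (L.br y z) x w - L.ter (L.br y w) x z + L.ter (L.br z w) x y

/-- `(φ₀, φ₁, φ₂)` is a homomorphism of Lie 2-algebras (an L-infinity morphism): a chain map that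
preserves the brackets up to the coherent homotopy `φ₂`. -/
structure LieTwo.IsHom (L : LieTwo V W) (L' : LieTwo V' W') (φ₀ : V →ₗ[ℝ] V') (φ₁ : W →ₗ[ℝ] W')
    (φ₂ : V → V → W') : Prop where
  lin : ∀ x, IsLinearMap ℝ (φ₂ x)
  skew : ∀ x y, φ₂ x y = -φ₂ y x
  chain : ∀ h, φ₀ (L.del h) = L'.del (φ₁ h)
  map_br : ∀ x y, φ₀ (L.br x y) - L'.br (φ₀ x) (φ₀ y) = L'.del (φ₂ x y)
  map_brW : ∀ x h, φ₁ (L.brW x h) - L'.brW (φ₀ x) (φ₁ h) = φ₂ x (L.del h)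
  map_ter : ∀ x y z, φ₁ (L.ter x y z) - L'.ter (φ₀ x) (φ₀ y) (φ₀ z) =
    (φ₂ (L.br x y) z - L'.brW (φ₀ z) (φ₂ x y)) + (φ₂ (L.br y z) x - L'.brW (φ₀ x) (φ₂ y z))
      + (φ₂ (L.br z x) y - L'.brW (φ₀ y) (φ₂ z x))

/-- Transport of the operations along an isomorphism `e : V ≃ V'` and the identity of `W`. -/
def LieTwo.transport (L : LieTwo V W) (e : V ≃ₗ[ℝ] V') : LieTwo V' W where
  del h := e (L.del h)
  br x y := e (L.br (e.symm x) (e.symm y))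
  brW x h := L.brW (e.symm x) h
  ter x y z := L.ter (e.symm x) (e.symm y) (e.symm z)

end LieTwo

/-! ### The higher Atiyah sequence of a gerbe and the standard Courant 2-algebra -/

section Gerbe

open TopologicalSpace (Opens)

variable (E : Type*) [NormedAddCommGroup E] [NormedSpace ℝ E] [FiniteDimensional ℝ E]
  {M : Type*} [TopologicalSpace M] [ChartedSpace E M] [IsManifold 𝓘(ℝ, E) ∞ M]
  {ι : Type*} (U : ι → Opens M)

variable (M) in
/-- `𝔛(M)` as a Lie 2-algebra concentrated in one degree. -/
def vectorFields : LieTwo (VF E M) PUnit where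
  del _ := 0
  br X Y := bracket X Y
  brW _ _ := 0
  ter _ _ _ := 0

/-- Gauge parameters `(ε_α)`, `ε_α ∈ C^∞(U_α)`. -/
abbrev Gauge : Type _ := ∀ α, Fn E (U α)

/-- Families `(ξ_α, f_αβ)` of 1-forms on the patches and of functions on the overlaps. -/
abbrev Cochain : Type _ := (∀ α, Form E (U α)) × (∀ α β, Fn E (U α ⊓ U β))

variable {E} {U}

/-- The Čech differential `(dε_α, ε_α - ε_β)` of a gauge parameter. -/
def gaugeD (ε : Gauge E U) : Cochain E U :=
  (fun α => dif (ε α), fun α β => restr inf_le_left (ε α) - restr inf_le_right (ε β))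

variable (E) (U)

/-- Objects of `H(M, Bℝ_conn)`: line bundles with connection `(ξ_α, f_αβ)`. -/
def LineBundle : Submodule ℝ (Cochain E U) where
  carrier := {a | (∀ α β, ∀ x ∈ U α ⊓ U β, (a.1 α).1 x - (a.1 β).1 x = (dif (a.2 α β)).1 x) ∧
    ∀ α β γ, ∀ x ∈ U α ⊓ U β ⊓ U γ, (a.2 α β).1 x + (a.2 β γ).1 x + (a.2 γ α).1 x = 0}
  add_mem' := fun {a b} ha hb => by
    refine ⟨fun α β x hx => ?_, fun α β γ x hx => ?_⟩
    · have h1 := ha.1 α β x hx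
      have h2 := hb.1 α β x hx
      refine Eq.trans ?_ (d_add (a.2 α β) (b.2 α β)).symm
      rw [← h1, ← h2]
      exact add_sub_add_comm _ _ _ _
    · have h1 := ha.2 α β γ x hx
      have h2 := hb.2 α β γ x hx
      have key : ∀ a b c d e f : ℝ, a + b + c = 0 → d + e + f = 0 →
        (a + d) + (b + e) + (c + f) = 0 := by intros; linarith
      exact key _ _ _ _ _ _ h1 h2
  zero_mem' := by
    refine ⟨fun α β x hx => ?_, fun α β γ x hx => ?_⟩
    swap
    · have key : (0 : ℝ) + 0 + 0 = 0 := by simp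
      exact key
    have h := d_smul (0 : ℝ) (0 : Fn E (U α ⊓ U β)) (x := x)
    rw [zero_smul, zero_smul] at h
    refine Eq.trans ?_ h.symm
    exact sub_self _
  smul_mem' := fun r a ha => by
    refine ⟨fun α β x hx => ?_, fun α β γ x hx => ?_⟩
    · have h1 := ha.1 α β x hx
      refine Eq.trans ?_ (d_smul r (a.2 α β)).symm
      rw [← h1]
      exact (smul_sub r ((a.1 α).1 x) ((a.1 β).1 x)).symm
    · have h1 := ha.2 α β γ x hx
      have key : ∀ a b c : ℝ, a + b + c = 0 → r * a + r * b + r * c = 0 := by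
        intro a b c h; rw [← mul_add, ← mul_add, h, mul_zero]
      exact key _ _ _ h1

variable {E} {U}

lemma gaugeD_mem (ε : Gauge E U) : gaugeD ε ∈ LineBundle E U := by
  refine ⟨fun α β x hx => ?_, fun α β γ x hx => ?_⟩
  · rw [d_val _ hx]
    have h : dFun (E := E) ((gaugeD ε).2 α β).1 x = dFun (ε α).1 x - dFun (ε β).1 x := by
      have h1 : ((gaugeD ε).2 α β).1 =ᶠ[𝓝 x] fun m => (ε α).1 m + (-1) * (ε β).1 m := by
        filter_upwards [(U α ⊓ U β).isOpen.mem_nhds hx] with m hm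
        refine (congrArg₂ (· - ·) (res_val _ _ hm) (res_val _ _ hm)).trans ?_
        ring
      rw [dFun_congr h1, dFun_add (g := fun m => (-1) * (ε β).1 m) ((ε α).2.1 x hx.1)
          (contMDiffAt_const.mul ((ε β).2.1 x hx.2)),
        dFun_smul (-1) ((ε β).2.1 x hx.2)]
      have key : ∀ p q : Covec E x, p + (-1 : ℝ) • q = p - q := fun p q => by
        have e : (-1 : ℝ) • q = -q := neg_one_smul ℝ q
        rw [e, sub_eq_add_neg]
      exact key _ _
    rw [h]
    exact congrArg₂ (· - ·) (d_val _ hx.1) (d_val _ hx.2)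
  · have h : ∀ α β, x ∈ U α ⊓ U β → ((gaugeD ε).2 α β).1 x = (ε α).1 x - (ε β).1 x :=
      fun α β hm => congrArg₂ (· - ·) (res_val _ _ hm) (res_val _ _ hm)
    rw [h α β hx.1, h β γ ⟨hx.1.2, hx.2⟩, h γ α ⟨hx.2, hx.1.1⟩]
    ring

variable (E) (U)

/-- `H(M, Bℝ_conn)` as an abelian Lie 2-algebra. -/
def lineBundles : LieTwo (LineBundle E U) (Gauge E U) where
  del ε := ⟨gaugeD ε, gaugeD_mem ε⟩
  br _ _ := 0
  brW _ _ := 0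
  ter _ _ _ := 0

/-- Čech data of a principal `BU(1)_conn`-bundle (a bundle gerbe with connective structure) on the
cover `U`. -/
structure GerbeCocycle where
  Λ : ∀ α β, Form E (U α ⊓ U β)
  G : ∀ α β γ, Fn E (U α ⊓ U β ⊓ U γ)
  Λ_skew : ∀ α β x, (Λ β α).1 x = -(Λ α β).1 x
  G_skew₁ : ∀ α β γ x, (G β α γ).1 x = -(G α β γ).1 x
  G_skew₂ : ∀ α β γ x, (G α γ β).1 x = -(G α β γ).1 x
  Λ_cocycle : ∀ α β γ, ∀ x ∈ U α ⊓ U β ⊓ U γ,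
    (Λ α β).1 x + (Λ β γ).1 x + (Λ γ α).1 x = (dif (G α β γ)).1 x
  G_cocycle : ∀ α β γ δ, ∀ x ∈ U α ⊓ U β ⊓ U γ ⊓ U δ, ∃ n : ℤ,
    (G α β γ).1 x - (G β γ δ).1 x + (G γ δ α).1 x - (G δ α β).1 x = 2 * Real.pi * n

variable {E} {U}

lemma act_add_left (X Y : VF E M) {V : Opens M} (f : Fn E V) :
    act (X + Y) f = act X f + act Y f := contract_add_left X Y _

lemma act_smul_left (r : ℝ) (X : VF E M) {V : Opens M} (f : Fn E V) :
    act (r • X) f = r • act X f := contract_smul_left r X _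

/-- Infinitesimal automorphisms of the gerbe: a vector field `X` together with local data
`(ξ_α, η_αβ)` that trivialise the Lie derivative `(L_X Λ_αβ, L_X G_αβγ)` of its cocycle. -/
def InfAut (c : GerbeCocycle E U) : Submodule ℝ (VF E M × Cochain E U) where
  carrier := {a |
    (∀ α β, ∀ x ∈ U α ⊓ U β, (a.2.1 α).1 x - (a.2.1 β).1 x =
      -(lie a.1 (c.Λ α β)).1 x + (dif (a.2.2 α β)).1 x) ∧
    ∀ α β γ, ∀ x ∈ U α ⊓ U β ⊓ U γ, (a.2.2 α β).1 x + (a.2.2 β γ).1 x + (a.2.2 γ α).1 x =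
      (act a.1 (c.G α β γ)).1 x}
  add_mem' := fun {a b} ha hb => by
    refine ⟨fun α β x hx => ?_, fun α β γ x hx => ?_⟩
    · have h1 := ha.1 α β x hx
      have h2 := hb.1 α β x hx
      have h3 := d_add (a.2.2 α β) (b.2.2 α β) (x := x)
      have h4 := lie_add_left a.1 b.1 (c.Λ α β) (x := x)
      have key : ∀ p q r s t u v w y z : Covec E x, p - q = -t + u → r - s = -v + w →
          y = u + w → z = t + v → (p + r) - (q + s) = -z + y := by
        intro p q r s t u v w y z i j k l
        rw [k, l, add_sub_add_comm, i, j]; abel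
      exact key _ _ _ _ _ _ _ _ _ _ h1 h2 h3 h4
    · have h1 := ha.2 α β γ x hx
      have h2 := hb.2 α β γ x hx
      have h3 := congrArg (fun f : Fn E (U α ⊓ U β ⊓ U γ) => f.1 x)
        (act_add_left a.1 b.1 (c.G α β γ))
      have key : ∀ a b c d e f g h i : ℝ, a + b + c = g → d + e + f = h → i = g + h →
        (a + d) + (b + e) + (c + f) = i := by intros; linarith
      exact key _ _ _ _ _ _ _ _ _ h1 h2 h3
  zero_mem' := by
    refine ⟨fun α β x hx => ?_, fun α β γ x hx => ?_⟩
    · have h := d_smul (0 : ℝ) (0 : Fn E (U α ⊓ U β)) (x := x)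
      rw [zero_smul, zero_smul] at h
      have h2 := lie_smul_left (0 : ℝ) (0 : VF E M) (c.Λ α β) (x := x)
      rw [zero_smul, zero_smul] at h2
      have key : ∀ y z : Covec E x, y = 0 → z = 0 → (0 : Covec E x) - 0 = -z + y := by
        rintro _ _ rfl rfl; simp
      exact key _ _ h h2
    · have h3 := congrArg (fun f : Fn E (U α ⊓ U β ⊓ U γ) => f.1 x)
        (act_smul_left (0 : ℝ) (0 : VF E M) (c.G α β γ))
      simp only [zero_smul] at h3
      have key : ∀ y : ℝ, y = 0 → (0 : ℝ) + 0 + 0 = y := by rintro _ rfl; simp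
      exact key _ h3
  smul_mem' := fun r a ha => by
    refine ⟨fun α β x hx => ?_, fun α β γ x hx => ?_⟩
    · have h1 := ha.1 α β x hx
      have h3 := d_smul r (a.2.2 α β) (x := x)
      have h4 := lie_smul_left r a.1 (c.Λ α β) (x := x)
      have key : ∀ p q t u y z : Covec E x, p - q = -t + u →
          y = r • u → z = r • t → r • p - r • q = -z + y := by
        intro p q t u y z i k l
        have e : r • p - r • q = r • (p - q) := (smul_sub r p q).symm
        have e' : r • (-t + u) = -(r • t) + r • u := by rw [smul_add, smul_neg]
        rw [k, l, e, i, e']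
      exact key _ _ _ _ _ _ h1 h3 h4
    · have h1 := ha.2 α β γ x hx
      have h3 := congrArg (fun f : Fn E (U α ⊓ U β ⊓ U γ) => f.1 x)
        (act_smul_left r a.1 (c.G α β γ))
      have key : ∀ a b c g i : ℝ, a + b + c = g → i = r * g →
        r * a + r * b + r * c = i := by intro a b c g i h k; rw [k, ← h]; ring
      exact key _ _ _ _ _ h1 h3

/-- The derivation action `L_X` of vector fields on cochains. -/
def lieCochain (X : VF E M) (a : Cochain E U) : Cochain E U :=
  (fun α => lie X (a.1 α), fun α β => act X (a.2 α β))

lemma lie_add_right (X : VF E M) {V : Opens M} (θ θ' : Form E V) :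
    lie X (θ + θ') = lie X θ + lie X θ' := by
  refine Subtype.ext (funext fun x => ?_)
  by_cases hx : x ∈ V
  · refine (lie_val _ _ hx).trans (Eq.trans ?_
      (congrArg₂ (· + ·) (lie_val X θ hx).symm (lie_val X θ' hx).symm))
    exact lieDer_add (vf_ev X x) (θ.2.1 x hx) (θ'.2.1 x hx)
  · refine ((lie X (θ + θ')).2.2 x hx).trans (Eq.trans ?_
      (congrArg₂ (· + ·) ((lie X θ).2.2 x hx).symm ((lie X θ').2.2 x hx).symm))
    exact (add_zero _).symm

lemma lie_smul_right (X : VF E M) {V : Opens M} (r : ℝ) (θ : Form E V) :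
    lie X (r • θ) = r • lie X θ := by
  refine Subtype.ext (funext fun x => ?_)
  by_cases hx : x ∈ V
  · refine (lie_val _ _ hx).trans (Eq.trans ?_ (congrArg (r • ·) (lie_val X θ hx).symm))
    exact lieDer_smul r (vf_ev X x) (θ.2.1 x hx)
  · refine ((lie X (r • θ)).2.2 x hx).trans (Eq.trans ?_
      (congrArg (r • ·) ((lie X θ).2.2 x hx).symm))
    exact (smul_zero r).symm

lemma lie_sub_right (X : VF E M) {V : Opens M} (θ θ' : Form E V) :
    lie X (θ - θ') = lie X θ - lie X θ' := by
  have e : θ - θ' + θ' = θ := Subtype.ext (sub_add_cancel θ.1 θ'.1)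
  have h := (lie_add_right X (θ - θ') θ').symm.trans (congrArg (lie X) e)
  refine Subtype.ext (funext fun x => ?_)
  have h1 : (lie X (θ - θ')).1 x + (lie X θ').1 x = (lie X θ).1 x :=
    congrFun (congrArg Subtype.val h) x
  exact eq_sub_of_add_eq h1

lemma lie_neg (X : VF E M) {V : Opens M} (θ : Form E V) : lie X (-θ) = -lie X θ := by
  have e : (-1 : ℝ) • θ = -θ := Subtype.ext (neg_one_smul ℝ θ.1)
  have h := lie_smul_right X (-1) θ
  rw [e] at h
  exact h.trans (Subtype.ext (neg_one_smul ℝ (lie X θ).1))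

lemma dif_add {V : Opens M} (f g : Fn E V) : dif (f + g) = dif f + dif g :=
  Subtype.ext (funext fun _ => d_add f g)

lemma dif_smul {V : Opens M} (r : ℝ) (f : Fn E V) : dif (r • f) = r • dif f :=
  Subtype.ext (funext fun _ => d_smul r f)

lemma dif_sub {V : Opens M} (f g : Fn E V) : dif (f - g) = dif f - dif g := by
  have e : f - g + g = f := Subtype.ext (sub_add_cancel f.1 g.1)
  have h := (dif_add (f - g) g).symm.trans (congrArg dif e)
  refine Subtype.ext (funext fun x => ?_)
  have h1 : (dif (f - g)).1 x + (dif g).1 x = (dif f).1 x :=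
    congrFun (congrArg Subtype.val h) x
  exact eq_sub_of_add_eq h1

lemma contract_add_right (X : VF E M) {V : Opens M} (θ θ' : Form E V) :
    contract X (θ + θ') = contract X θ + contract X θ' := rfl

lemma contract_smul_right (X : VF E M) {V : Opens M} (r : ℝ) (θ : Form E V) :
    contract X (r • θ) = r • contract X θ := rfl

lemma act_add_right (X : VF E M) {V : Opens M} (f g : Fn E V) :
    act X (f + g) = act X f + act X g := by
  unfold act; rw [dif_add, contract_add_right]

lemma act_smul_right (X : VF E M) {V : Opens M} (r : ℝ) (f : Fn E V) :
    act X (r • f) = r • act X f := by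
  unfold act; rw [dif_smul, contract_smul_right]

/-- Restriction of 1-forms to a smaller open set. -/
def restrForm {V W : Opens M} (h : V ≤ W) (θ : Form E W) : Form E V :=
  formOf V θ.1 fun x hx => θ.2.1 x (h hx)

lemma restrForm_val {V W : Opens M} (h : V ≤ W) (θ : Form E W) {x : M} (hx : x ∈ V) :
    (restrForm h θ).1 x = θ.1 x := cutForm_of_mem hx

lemma lie_restr (X : VF E M) {V W : Opens M} (h : V ≤ W) (θ : Form E W) {x : M} (hx : x ∈ V) :
    (lie X (restrForm h θ)).1 x = (lie X θ).1 x := by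
  rw [lie_val _ _ hx, lie_val _ _ (h hx)]
  refine lieDer_congr ?_
  filter_upwards [V.isOpen.mem_nhds hx] with m hm
  exact restrForm_val h θ hm

lemma act_restr (X : VF E M) {V W : Opens M} (h : V ≤ W) (f : Fn E W) {x : M} (hx : x ∈ V) :
    (act X (restr h f)).1 x = (act X f).1 x :=
  act_congr X _ _ le_rfl h (fun _ hm => res_val h f hm) hx

lemma form_ext {V : Opens M} {θ θ' : Form E V} (h : ∀ x ∈ V, θ.1 x = θ'.1 x) : θ = θ' := by
  refine Subtype.ext (funext fun x => ?_)
  by_cases hx : x ∈ V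
  · exact h x hx
  · rw [θ.2.2 x hx, θ'.2.2 x hx]

lemma fn_ext {V : Opens M} {f g : Fn E V} (h : ∀ x ∈ V, f.1 x = g.1 x) : f = g := by
  refine Subtype.ext (funext fun x => ?_)
  by_cases hx : x ∈ V
  · exact h x hx
  · rw [f.2.2 x hx, g.2.2 x hx]

/-- If `ξ_α - ξ_β = θ` on an overlap, then `L_X ξ_α - L_X ξ_β = L_X θ` there. -/
lemma lie_glue (X : VF E M) {V W : Opens M} (ξ : Form E V) (ξ' : Form E W)
    (θ : Form E (V ⊓ W)) (h : ∀ x ∈ V ⊓ W, ξ.1 x - ξ'.1 x = θ.1 x) {x : M} (hx : x ∈ V ⊓ W) :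
    (lie X ξ).1 x - (lie X ξ').1 x = (lie X θ).1 x := by
  have e : restrForm inf_le_left ξ - restrForm inf_le_right ξ' = θ :=
    form_ext fun m hm => (congrArg₂ (· - ·) (restrForm_val _ ξ hm) (restrForm_val _ ξ' hm)).trans
      (h m hm)
  rw [← e, lie_sub_right]
  exact (congrArg₂ (· - ·) (lie_restr X inf_le_left ξ hx) (lie_restr X inf_le_right ξ' hx)).symm

/-- If `a + b + c = g` on a triple overlap, then `X(a) + X(b) + X(c) = X(g)` there. -/
lemma act_glue (X : VF E M) {A B C W : Opens M} (a : Fn E A) (b : Fn E B) (c : Fn E C)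
    (g : Fn E W) (hA : W ≤ A) (hB : W ≤ B) (hC : W ≤ C)
    (h : ∀ x ∈ W, a.1 x + b.1 x + c.1 x = g.1 x) {x : M} (hx : x ∈ W) :
    (act X a).1 x + (act X b).1 x + (act X c).1 x = (act X g).1 x := by
  have e : restr hA a + restr hB b + restr hC c = g :=
    fn_ext fun m hm => by
      rw [← h m hm, ← res_val hA a hm, ← res_val hB b hm, ← res_val hC c hm]; rfl
  rw [← e, act_add_right, act_add_right, ← act_restr X hA a hx, ← act_restr X hB b hx,
    ← act_restr X hC c hx]
  rfl

/-- The bracket of infinitesimal automorphisms,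
`[(X, a), (Y, b)] = ([X, Y], L_X b - L_Y a)`. -/
def infAutBr (c : GerbeCocycle E U) (a b : InfAut c) : InfAut c :=
  ⟨(bracket a.1.1 b.1.1, lieCochain a.1.1 b.1.2 - lieCochain b.1.1 a.1.2), by
    refine ⟨fun α β x hx => ?_, fun α β γ x hx => ?_⟩
    · have h1 := lie_glue a.1.1 (b.1.2.1 α) (b.1.2.1 β)
        (-lie b.1.1 (c.Λ α β) + dif (b.1.2.2 α β)) (b.2.1 α β) hx
      have h2 := lie_glue b.1.1 (a.1.2.1 α) (a.1.2.1 β)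
        (-lie a.1.1 (c.Λ α β) + dif (a.1.2.2 α β)) (a.2.1 α β) hx
      have e : ∀ (X : VF E M) (θ : Form E (U α ⊓ U β)) (f : Fn E (U α ⊓ U β)),
          (lie X (-θ + dif f)).1 x = -(lie X θ).1 x + (dif (act X f)).1 x := by
        intro X θ f
        rw [lie_add_right, lie_neg]
        exact congrArg (-(lie X θ).1 x + ·) (lie_d X f hx)
      rw [e] at h1 h2
      have h3 := lie_bracket a.1.1 b.1.1 (c.Λ α β) hx
      have h4 := congrArg (fun θ : Form E (U α ⊓ U β) => θ.1 x)
        (dif_sub (act a.1.1 (b.1.2.2 α β)) (act b.1.1 (a.1.2.2 α β)))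
      have key : ∀ p q r s t u v w y z : Covec E x, p - q = -t + u → r - s = -v + w →
          z = t - v → y = u - w → (p - r) - (q - s) = -z + y := by
        intro p q r s t u v w y z i j k l
        rw [k, l, sub_sub_sub_comm, i, j]; abel
      exact key _ _ _ _ _ _ _ _ _ _ h1 h2 h3 h4
    · have hαβ : U α ⊓ U β ⊓ U γ ≤ U α ⊓ U β := inf_le_left
      have hβγ : U α ⊓ U β ⊓ U γ ≤ U β ⊓ U γ := inf_le_inf_right _ inf_le_right
      have hγα : U α ⊓ U β ⊓ U γ ≤ U γ ⊓ U α :=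
        le_inf inf_le_right (inf_le_left.trans inf_le_left)
      have h1 := act_glue a.1.1 _ _ _ _ hαβ hβγ hγα (b.2.2 α β γ) hx
      have h2 := act_glue b.1.1 _ _ _ _ hαβ hβγ hγα (a.2.2 α β γ) hx
      have h3 := act_bracket a.1.1 b.1.1 (c.G α β γ) hx
      have key : ∀ p q r s t u v w z : ℝ, p + q + r = v → s + t + u = w → z = v - w →
        (p - s) + (q - t) + (r - u) = z := by intros; linarith
      exact key _ _ _ _ _ _ _ _ _ h1 h2 h3⟩

/-- The inclusion of line bundles with connection as the infinitesimal automorphisms over `0`. -/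
def incl (c : GerbeCocycle E U) : LineBundle E U →ₗ[ℝ] InfAut c where
  toFun a := ⟨(0, a.1), by
    have hl : ∀ (V : Opens M) (θ : Form E V) x, (lie (0 : VF E M) θ).1 x = 0 := by
      intro V θ x
      have h2 := lie_smul_left (0 : ℝ) (0 : VF E M) θ (x := x)
      rwa [zero_smul, zero_smul] at h2
    have ha : ∀ (V : Opens M) (f : Fn E V), act (0 : VF E M) f = 0 := by
      intro V f
      have h3 := act_smul_left (0 : ℝ) (0 : VF E M) f
      rwa [zero_smul, zero_smul] at h3
    refine ⟨fun α β x hx => ?_, fun α β γ x hx => ?_⟩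
    · rw [hl, neg_zero]
      refine Eq.trans (a.2.1 α β x hx) ?_
      exact (zero_add _).symm
    · rw [ha]
      exact a.2.2 α β γ x hx⟩
  map_add' a b := Subtype.ext (Prod.ext (add_zero (0 : VF E M)).symm rfl)
  map_smul' r a := Subtype.ext (Prod.ext (smul_zero r).symm rfl)

/-- The anchor `(X, ξ, η) ↦ X`. -/
def anchor (c : GerbeCocycle E U) : InfAut c →ₗ[ℝ] VF E M where
  toFun a := a.1.1
  map_add' _ _ := rfl
  map_smul' _ _ := rfl

/-- The Atiyah Lie 2-algebra `at(𝓜)` of the gerbe. -/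
def atiyah (c : GerbeCocycle E U) : LieTwo (InfAut c) (Gauge E U) where
  del ε := incl c ⟨gaugeD ε, gaugeD_mem ε⟩
  br := infAutBr c
  brW a ε := fun α => act a.1.1 (ε α)
  ter _ _ _ := 0

/-- The shifted functions `f_αβ = η_αβ - ι_X Λ_αβ` of an infinitesimal automorphism. -/
def shifted (c : GerbeCocycle E U) (a : InfAut c) (α β : ι) : Fn E (U α ⊓ U β) :=
  a.1.2.2 α β - contract a.1.1 (c.Λ α β)

/-- The binary standard Courant bracket on line bundles with connection and vector fields. -/
def courantBr (u v : VF E M × LineBundle E U) : VF E M × LineBundle E U :=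
  (bracket u.1 v.1,
    ⟨(fun α => lie u.1 (v.2.1.1 α) - lie v.1 (u.2.1.1 α)
        - (1 / 2 : ℝ) • dif (contract u.1 (v.2.1.1 α) - contract v.1 (u.2.1.1 α)),
      fun α β => (1 / 2 : ℝ) • act u.1 (v.2.1.2 α β) - (1 / 2 : ℝ) • act v.1 (u.2.1.2 α β)), by
    refine ⟨fun α β x hx => ?_, fun α β γ x hx => ?_⟩
    · have hc : ∀ (X : VF E M) (a : LineBundle E U),
          (dif (contract X (a.1.1 α))).1 x - (dif (contract X (a.1.1 β))).1 x =
            (dif (act X (a.1.2 α β))).1 x := by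
        intro X a
        have e : restr inf_le_left (contract X (a.1.1 α)) -
            restr inf_le_right (contract X (a.1.1 β)) = act X (a.1.2 α β) :=
          fn_ext fun m hm => by
            refine (congrArg₂ (· - ·) (res_val _ _ hm) (res_val _ _ hm)).trans ?_
            exact congrArg (fun t : Covec E m => (t (X m) : ℝ)) (a.2.1 α β m hm)
        rw [← e, dif_sub]
        have hr : ∀ {V W : Opens M} (h : V ≤ W) (f : Fn E W), x ∈ V →
            (dif (restr h f)).1 x = (dif f).1 x := by
          intro V W h f hm
          rw [d_val _ hm, d_val _ (h hm)]
          refine dFun_congr ?_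
          filter_upwards [V.isOpen.mem_nhds hm] with m hm
          exact res_val h f hm
        exact (congrArg₂ (· - ·) (hr _ _ hx) (hr _ _ hx)).symm
      have h1 := hc u.1 v.2
      have h2 := hc v.1 u.2
      have h3 := (lie_glue u.1 _ _ _ (v.2.2.1 α β) hx).trans (lie_d u.1 _ hx)
      have h4 := (lie_glue v.1 _ _ _ (u.2.2.1 α β) hx).trans (lie_d v.1 _ hx)
      have hd : ∀ δ, (dif (contract u.1 (v.2.1.1 δ) - contract v.1 (u.2.1.1 δ))).1 x =
          (dif (contract u.1 (v.2.1.1 δ))).1 x - (dif (contract v.1 (u.2.1.1 δ))).1 x :=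
        fun δ => congrFun (congrArg Subtype.val (dif_sub _ _)) x
      have h5 : (dif ((1 / 2 : ℝ) • act u.1 (v.2.1.2 α β) - (1 / 2 : ℝ) • act v.1 (u.2.1.2 α β))).1
          x = (1 / 2 : ℝ) • (dif (act u.1 (v.2.1.2 α β))).1 x
            - (1 / 2 : ℝ) • (dif (act v.1 (u.2.1.2 α β))).1 x := by
        rw [dif_sub, dif_smul, dif_smul]; rfl
      have key : ∀ p q r s t t' v v' y z a b c : Covec E x, p - q = y → r - s = z → t - t' = y →
          v - v' = z → a = t - v → b = t' - v' → c = (1 / 2 : ℝ) • y - (1 / 2 : ℝ) • z →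
          (p - r - (1 / 2 : ℝ) • a) - (q - s - (1 / 2 : ℝ) • b) = c := by
        intro p q r s t t' v v' y z a b c i j k l ha hb hc'
        rw [ha, hb, hc']
        have e1 : p = q + y := by rw [← i]; abel
        have e2 : r = s + z := by rw [← j]; abel
        have e3 : t = t' + y := by rw [← k]; abel
        have e4 : v = v' + z := by rw [← l]; abel
        rw [e1, e2, e3, e4]
        module
      exact key _ _ _ _ _ _ _ _ _ _ _ _ _ h3 h4 h1 h2 (hd α) (hd β) h5
    · have hz : ∀ (X : VF E M) (a : LineBundle E U), (act X (a.1.2 α β)).1 x +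
          (act X (a.1.2 β γ)).1 x + (act X (a.1.2 γ α)).1 x = 0 := by
        intro X a
        have hαβ : U α ⊓ U β ⊓ U γ ≤ U α ⊓ U β := inf_le_left
        have hβγ : U α ⊓ U β ⊓ U γ ≤ U β ⊓ U γ := inf_le_inf_right _ inf_le_right
        have hγα : U α ⊓ U β ⊓ U γ ≤ U γ ⊓ U α :=
          le_inf inf_le_right (inf_le_left.trans inf_le_left)
        have h1 := act_glue X _ _ _ (0 : Fn E (U α ⊓ U β ⊓ U γ)) hαβ hβγ hγα (a.2.2 α β γ) hx
        have h3 := act_smul_right X (0 : ℝ) (0 : Fn E (U α ⊓ U β ⊓ U γ))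
        rw [zero_smul, zero_smul] at h3
        rw [h3] at h1
        exact h1
      have h1 := hz u.1 v.2
      have h2 := hz v.1 u.2
      have key : ∀ p q r s t u : ℝ, p + q + r = 0 → s + t + u = 0 →
        ((1 / 2 : ℝ) * p - (1 / 2 : ℝ) * s) + ((1 / 2 : ℝ) * q - (1 / 2 : ℝ) * t) +
          ((1 / 2 : ℝ) * r - (1 / 2 : ℝ) * u) = 0 := by intros; linarith
      exact key _ _ _ _ _ _ h1 h2⟩)

/-- The function `ι_X ι_Y dζ + ι_X d ι_Y ζ`. -/
def courantTri (X Y : VF E M) {V : Opens M} (ζ : Form E V) : Fn E V :=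
  contract X (contractD Y ζ) + contract X (dif (contract Y ζ))

variable (E) (U)

/-- The standard Courant 2-algebra `𝔛(M) ⊕ H(M, Bℝ_conn)`. -/
def standardCourant : LieTwo (VF E M × LineBundle E U) (Gauge E U) where
  del ε := (0, ⟨gaugeD ε, gaugeD_mem ε⟩)
  br := courantBr
  brW u ε := fun α => (1 / 2 : ℝ) • act u.1 (ε α)
  ter u v w := fun α => (1 / 4 : ℝ) •
    (courantTri u.1 v.1 (w.2.1.1 α) - courantTri v.1 u.1 (w.2.1.1 α)
      + courantTri v.1 w.1 (u.2.1.1 α) - courantTri w.1 v.1 (u.2.1.1 α)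
      + courantTri w.1 u.1 (v.2.1.1 α) - courantTri u.1 w.1 (v.2.1.1 α))

end Gerbe
end HigherAtiyah

end

/-!
The statement reduces to Cartan calculus on the patches of the cover, plus one partition of unity.

All structures are built from `d`, `ι_X`, `L_X` on functions and 1-forms and the bracket of vector
fields. These operations are packaged as (bi)linear maps `difₗ`, `contractₗ`, `lieₗ`, `actₗ`,
`bracketₗ`, subject to `L_[X,Y] = [L_X, L_Y]`, `L_X d = d L_X` and `ι_Y L_X = X ι_Y - ι_[X,Y]`
(`lieₗ_bracketₗ`, `lieₗ_difₗ`, `contractₗ_lieₗ`); with them every law becomes a linear identity in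
`Ω¹(U_α)` or `C^∞(U_α)`.

* The native brackets of the Atiyah Lie 2-algebra are the commutator action of `𝔛(M)` on cochains,
  so its Jacobi identities hold strictly (`atiyah_isLie`).
* The Courant bracket involves `L_X - ½ d ι_X` (`courantLie`), whose failure to be an action is the
  differential of `¼ (ι_X L_Y - ι_Y L_X)` (`courantLie_bracket`). The cyclic sum of the latter is the
  ternary bracket. Its coherence law is additive in the 1-forms of the arguments, hence follows from
  the case of a single 1-form (`courantAlt_coherence`).
* A vector field `X` lifts to an infinitesimal automorphism (`anchor_surjective`). The condition that
  `G` is a cocycle up to locally constant functions becomes exact after differentiation along `X`,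
  and a partition of unity `ρ` gives the primitives `η_αβ = Σ_δ ρ_δ X(G_αβδ)` and
  `ξ_α = Σ_δ ρ_δ (dη_αδ - L_X Λ_αδ)`.
* The shift `f_αβ = η_αβ - ι_X Λ_αβ` removes the exact parts of `L_X Λ = ι_X dΛ + d ι_X Λ` and of
  `X(G) = ι_X dG` (`mem_infAut_iff`).
* For a homomorphic splitting `(s, s₂)`, the Courant bracket of `(X, ξ)` and `(Y, η)` differs from the
  native one by the coboundary of `-½ (ι_X η - ι_Y ξ)`; hence `φ₂ = s₂ - ½ (ι_X η - ι_Y ξ)` extends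
  `s ⊕ i` to a homomorphism (`splittingEquiv_isHom`). Precomposing with the inverse of `s ⊕ i` settles
  the transported structure (`LieTwo.IsHom.of_transport`).
-/

namespace HigherAtiyah

open TopologicalSpace (Opens)

set_option linter.unusedSectionVars false

section CartanCalculus

variable {E : Type*} [NormedAddCommGroup E] [NormedSpace ℝ E] [FiniteDimensional ℝ E]
  {M : Type*} [TopologicalSpace M] [ChartedSpace E M] [IsManifold 𝓘(ℝ, E) ∞ M]

/-! ### The Lie algebra of vector fields -/

lemma vf_mdifferentiableAt (X : VF E M) (x : M) :
    MDifferentiableAt 𝓘(ℝ, E) (𝓘(ℝ, E).prod 𝓘(ℝ, E)) (fun m => TotalSpace.mk' E m (X m)) x :=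
  (vf_smoothAt X x).mdifferentiableAt (by simp)

lemma bracket_add_left (X Y Z : VF E M) : bracket (X + Y) Z = bracket X Z + bracket Y Z := by
  have := FiniteDimensional.complete ℝ E
  ext x
  exact mlieBracket_add_left (vf_mdifferentiableAt X x) (vf_mdifferentiableAt Y x)

lemma bracket_smul_left (r : ℝ) (X Y : VF E M) : bracket (r • X) Y = r • bracket X Y := by
  have := FiniteDimensional.complete ℝ E
  ext x
  exact mlieBracket_const_smul_left (vf_mdifferentiableAt X x)

lemma bracket_skew (X Y : VF E M) : bracket X Y = -bracket Y X := by
  ext x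
  exact mlieBracket_swap_apply

lemma bracket_jacobi (X Y Z : VF E M) :
    bracket (bracket X Y) Z + bracket (bracket Y Z) X + bracket (bracket Z X) Y = 0 := by
  have := FiniteDimensional.complete ℝ E
  have i3 : IsManifold 𝓘(ℝ, E) (minSmoothness ℝ 3) M := by
    rw [minSmoothness_of_isRCLikeNormedField]
    exact IsManifold.of_le (n := ∞) (mod_cast le_top : ((3 : ℕ∞) : WithTop ℕ∞) ≤ ∞)
  have i (V : VF E M) (x : M) : ContMDiffAt 𝓘(ℝ, E) (𝓘(ℝ, E).prod 𝓘(ℝ, E)) (minSmoothness ℝ 2)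
      (fun m => TotalSpace.mk' E m (V m)) x := by
    rw [minSmoothness_of_isRCLikeNormedField]
    exact (vf_smoothAt V x).of_le (mod_cast le_top : ((2 : ℕ∞) : WithTop ℕ∞) ≤ ∞)
  have h : bracket X (bracket Y Z) = bracket (bracket X Y) Z + bracket Y (bracket X Z) := by
    ext x
    exact leibniz_identity_mlieBracket_apply (i X x) (i Y x) (i Z x)
  rw [bracket_skew (bracket Y Z) X, bracket_skew (bracket Z X) Y, bracket_skew Z X, h]
  have hn : bracket Y (-bracket X Z) = -bracket Y (bracket X Z) := by
    rw [bracket_skew, bracket_skew Y (bracket X Z), ← neg_one_smul ℝ (bracket X Z),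
      bracket_smul_left, neg_one_smul]
  rw [hn]
  abel

/-- The Lie bracket of vector fields as a bilinear map. -/
noncomputable def bracketₗ : VF E M →ₗ[ℝ] VF E M →ₗ[ℝ] VF E M :=
  LinearMap.mk₂ ℝ bracket bracket_add_left bracket_smul_left
    (fun X Y Z => by
      rw [bracket_skew, bracket_add_left, bracket_skew Y X, bracket_skew Z X, neg_add,
        neg_neg, neg_neg])
    (fun r X Y => by rw [bracket_skew, bracket_smul_left, bracket_skew Y X, smul_neg,
      neg_neg])

/-! ### Cartan calculus on functions and 1-forms -/

variable {V W : Opens M}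

lemma Fn.add_val (f g : Fn E V) (x : M) : (f + g).1 x = f.1 x + g.1 x := rfl

lemma Fn.sub_val (f g : Fn E V) (x : M) : (f - g).1 x = f.1 x - g.1 x := rfl

lemma Fn.smul_val (r : ℝ) (f : Fn E V) (x : M) : (r • f).1 x = r * f.1 x := rfl

lemma Form.add_val (f g : Form E V) (x : M) : (f + g).1 x = f.1 x + g.1 x := rfl

lemma Form.sub_val (f g : Form E V) (x : M) : (f - g).1 x = f.1 x - g.1 x := rfl

/-- The differential as a linear map. -/
noncomputable def difₗ : Fn E V →ₗ[ℝ] Form E V where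
  toFun := dif
  map_add' := dif_add
  map_smul' := dif_smul

/-- Contraction of a 1-form with a vector field as a bilinear map. -/
noncomputable def contractₗ : VF E M →ₗ[ℝ] Form E V →ₗ[ℝ] Fn E V :=
  LinearMap.mk₂ ℝ (contract (U := V)) (fun X Y => contract_add_left X Y)
    (fun r X => contract_smul_left r X) (fun X => contract_add_right X)
    fun r X => contract_smul_right X r

/-- The derivative of a function along a vector field as a bilinear map. -/
noncomputable def actₗ : VF E M →ₗ[ℝ] Fn E V →ₗ[ℝ] Fn E V :=
  LinearMap.mk₂ ℝ (act (U := V)) (fun X Y => act_add_left X Y)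
    (fun r X => act_smul_left r X) (fun X => act_add_right X) fun r X => act_smul_right X r

/-- The Lie derivative of a 1-form along a vector field as a bilinear map. -/
noncomputable def lieₗ : VF E M →ₗ[ℝ] Form E V →ₗ[ℝ] Form E V :=
  LinearMap.mk₂ ℝ (lie (U := V)) (fun X Y θ => form_ext fun _ _ => lie_add_left X Y θ)
    (fun r X θ => form_ext fun _ _ => lie_smul_left r X θ) (fun X => lie_add_right X)
    fun r X => lie_smul_right X r

/-- Restriction of functions as a linear map. -/
noncomputable def restrₗ (h : V ≤ W) : Fn E W →ₗ[ℝ] Fn E V where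
  toFun := restr h
  map_add' f g := fn_ext fun x hx => by
    rw [Fn.add_val, res_val h _ hx, res_val h _ hx, res_val h _ hx, Fn.add_val]
  map_smul' r f := fn_ext fun x hx => by
    rw [RingHom.id_apply, Fn.smul_val, res_val h _ hx, res_val h _ hx, Fn.smul_val]

lemma difₗ_apply (f : Fn E V) : difₗ f = dif f := rfl

lemma actₗ_apply (X : VF E M) (f : Fn E V) : actₗ X f = act X f := rfl

lemma lieₗ_apply (X : VF E M) (θ : Form E V) : lieₗ X θ = lie X θ := rfl

lemma contractₗ_difₗ (X : VF E M) (f : Fn E V) : contractₗ X (difₗ f) = actₗ X f := rfl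

lemma lieₗ_difₗ (X : VF E M) (f : Fn E V) : lieₗ X (difₗ f) = difₗ (actₗ X f) :=
  form_ext fun _ hx => lie_d X f hx

lemma actₗ_bracketₗ (X Y : VF E M) (f : Fn E V) :
    actₗ (bracketₗ X Y) f = actₗ X (actₗ Y f) - actₗ Y (actₗ X f) :=
  fn_ext fun _ hx => act_bracket X Y f hx

lemma lieₗ_bracketₗ (X Y : VF E M) (θ : Form E V) :
    lieₗ (bracketₗ X Y) θ = lieₗ X (lieₗ Y θ) - lieₗ Y (lieₗ X θ) :=
  form_ext fun _ hx => lie_bracket X Y θ hx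

/-- `ι_Y L_X = X ι_Y - ι_[X,Y]` on 1-forms. -/
lemma contractₗ_lieₗ (X Y : VF E M) (θ : Form E V) :
    contractₗ Y (lieₗ X θ) = actₗ X (contractₗ Y θ) - contractₗ (bracketₗ X Y) θ := by
  refine fn_ext fun x hx => ?_
  have h1 := lieDer_apply (θ.2.1 x hx) (vf_smoothAt X x) (vf_smoothAt Y x)
  have h2 : (contract Y (lie X θ)).1 x = (lieDer (fun m => X m) θ.1 x (Y x) : ℝ) :=
    congrArg (fun t : Covec E x => (t (Y x) : ℝ)) (lie_val X θ hx)
  have h3 : (act X (contract Y θ)).1 x =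
      (dFun (fun m => (θ.1 m (Y m) : ℝ)) x (X x) : ℝ) := act_val X (contract Y θ) hx
  exact (h2.trans h1).trans (congrArg (· - (contract (bracket X Y) θ).1 x) h3.symm)

/-- The summand `ι_X ι_Y dζ + ι_X d ι_Y ζ` of the ternary Courant bracket is `ι_X L_Y ζ`. -/
lemma courantTri_eq (X Y : VF E M) (ζ : Form E V) :
    courantTri X Y ζ = actₗ Y (contractₗ X ζ) - contractₗ (bracketₗ Y X) ζ := by
  rw [← contractₗ_lieₗ]
  exact (contract_add_right X (contractD Y ζ) (dif (contract Y ζ))).symm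

lemma actₗ_restrₗ (X : VF E M) (h : V ≤ W) (f : Fn E W) :
    actₗ X (restrₗ h f) = restrₗ h (actₗ X f) :=
  fn_ext fun _ hx => (act_restr X h f hx).trans (res_val h _ hx).symm

end CartanCalculus

/-! ### Line bundles with connection, vector fields and the Atiyah Lie 2-algebra -/

section LieTwoAlgebras

variable {E : Type*} [NormedAddCommGroup E] [NormedSpace ℝ E] [FiniteDimensional ℝ E]
  {M : Type*} [TopologicalSpace M] [ChartedSpace E M] [IsManifold 𝓘(ℝ, E) ∞ M]
  {ι : Type*} {U : ι → Opens M}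

lemma lineBundle_ext {a b : LineBundle E U} (h1 : ∀ α, a.1.1 α = b.1.1 α)
    (h2 : ∀ α β, a.1.2 α β = b.1.2 α β) : a = b :=
  Subtype.ext (Prod.ext (funext h1) (funext fun α => funext (h2 α)))

lemma infAut_ext {c : GerbeCocycle E U} {a b : InfAut c} (h : a.1.1 = b.1.1)
    (h1 : ∀ α, a.1.2.1 α = b.1.2.1 α) (h2 : ∀ α β, a.1.2.2 α β = b.1.2.2 α β) : a = b :=
  Subtype.ext (Prod.ext h (Prod.ext (funext h1) (funext fun α => funext (h2 α))))

/-- The Čech differential of gauge parameters as a linear map. -/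
noncomputable def gaugeDₗ : Gauge E U →ₗ[ℝ] LineBundle E U where
  toFun ε := ⟨gaugeD ε, gaugeD_mem ε⟩
  map_add' ε ε' := lineBundle_ext (fun α => map_add difₗ (ε α) (ε' α)) fun α β => by
    have h1 := map_add (restrₗ (inf_le_left : U α ⊓ U β ≤ U α)) (ε α) (ε' α)
    have h2 := map_add (restrₗ (inf_le_right : U α ⊓ U β ≤ U β)) (ε β) (ε' β)
    exact (congrArg₂ (· - ·) h1 h2).trans (add_sub_add_comm _ _ _ _)
  map_smul' r ε := lineBundle_ext (fun α => map_smul difₗ r (ε α)) fun α β => by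
    have h1 := map_smul (restrₗ (inf_le_left : U α ⊓ U β ≤ U α)) r (ε α)
    have h2 := map_smul (restrₗ (inf_le_right : U α ⊓ U β ≤ U β)) r (ε β)
    exact (congrArg₂ (· - ·) h1 h2).trans (smul_sub _ _ _).symm

lemma lineBundles_isLie : (lineBundles E U).IsLie where
  del_lin := (gaugeDₗ (E := E) (U := U)).isLinear
  br_lin _ := (0 : LineBundle E U →ₗ[ℝ] LineBundle E U).isLinear
  br_skew _ _ := neg_zero.symm
  brW_lin_left _ := (0 : LineBundle E U →ₗ[ℝ] Gauge E U).isLinear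
  brW_lin_right _ := (0 : Gauge E U →ₗ[ℝ] Gauge E U).isLinear
  ter_lin _ _ := (0 : LineBundle E U →ₗ[ℝ] Gauge E U).isLinear
  ter_skew₁ _ _ _ := neg_zero.symm
  ter_skew₂ _ _ _ := neg_zero.symm
  del_brW _ _ := map_zero (gaugeDₗ (E := E) (U := U))
  brW_del _ _ := neg_zero.symm
  jacobi _ _ _ := by
    refine Eq.trans ?_ (map_zero (gaugeDₗ (E := E) (U := U))).symm
    simp [lineBundles]
  jacobiW _ _ _ := by simp [lineBundles]
  coherence _ _ _ _ := by simp [lineBundles]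

lemma vectorFields_isLie : (vectorFields E M).IsLie where
  del_lin := ⟨fun _ _ => (add_zero _).symm, fun r _ => (smul_zero r).symm⟩
  br_lin X := (bracketₗ X).isLinear
  br_skew := bracket_skew
  brW_lin_left _ := ⟨fun _ _ => rfl, fun _ _ => rfl⟩
  brW_lin_right _ := ⟨fun _ _ => rfl, fun _ _ => rfl⟩
  ter_lin _ _ := ⟨fun _ _ => rfl, fun _ _ => rfl⟩
  ter_skew₁ _ _ _ := rfl
  ter_skew₂ _ _ _ := rfl
  del_brW X _ := (map_zero (bracketₗ X)).symm
  brW_del _ _ := rfl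
  jacobi := bracket_jacobi
  jacobiW _ _ _ := rfl
  coherence _ _ _ _ := rfl

lemma incl_fst (c : GerbeCocycle E U) (a : LineBundle E U) : (incl c a).1.1 = 0 := rfl

lemma incl_form (c : GerbeCocycle E U) (a : LineBundle E U) (α : ι) :
    (incl c a).1.2.1 α = a.1.1 α := rfl

lemma incl_fn (c : GerbeCocycle E U) (a : LineBundle E U) (α β : ι) :
    (incl c a).1.2.2 α β = a.1.2 α β := rfl

lemma gaugeDₗ_form (ε : Gauge E U) (α : ι) : (gaugeDₗ ε).1.1 α = difₗ (ε α) := rfl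

lemma gaugeDₗ_fn (ε : Gauge E U) (α β : ι) :
    (gaugeDₗ ε).1.2 α β = restrₗ inf_le_left (ε α) - restrₗ inf_le_right (ε β) := rfl

lemma infAutBr_fst (c : GerbeCocycle E U) (a b : InfAut c) :
    (infAutBr c a b).1.1 = bracketₗ a.1.1 b.1.1 := rfl

lemma infAutBr_form (c : GerbeCocycle E U) (a b : InfAut c) (α : ι) :
    (infAutBr c a b).1.2.1 α = lieₗ a.1.1 (b.1.2.1 α) - lieₗ b.1.1 (a.1.2.1 α) := rfl

lemma infAutBr_fn (c : GerbeCocycle E U) (a b : InfAut c) (α β : ι) :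
    (infAutBr c a b).1.2.2 α β = actₗ a.1.1 (b.1.2.2 α β) - actₗ b.1.1 (a.1.2.2 α β) := rfl

lemma infAut_add_fst {c : GerbeCocycle E U} (a b : InfAut c) : (a + b).1.1 = a.1.1 + b.1.1 := rfl

lemma infAut_add_form {c : GerbeCocycle E U} (a b : InfAut c) (α : ι) :
    (a + b).1.2.1 α = a.1.2.1 α + b.1.2.1 α := rfl

lemma infAut_add_fn {c : GerbeCocycle E U} (a b : InfAut c) (α β : ι) :
    (a + b).1.2.2 α β = a.1.2.2 α β + b.1.2.2 α β := rfl

lemma infAut_smul_fst {c : GerbeCocycle E U} (r : ℝ) (a : InfAut c) :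
    (r • a).1.1 = r • a.1.1 := rfl

lemma infAut_smul_form {c : GerbeCocycle E U} (r : ℝ) (a : InfAut c) (α : ι) :
    (r • a).1.2.1 α = r • a.1.2.1 α := rfl

lemma infAut_smul_fn {c : GerbeCocycle E U} (r : ℝ) (a : InfAut c) (α β : ι) :
    (r • a).1.2.2 α β = r • a.1.2.2 α β := rfl

lemma infAut_sub_fst {c : GerbeCocycle E U} (a b : InfAut c) : (a - b).1.1 = a.1.1 - b.1.1 := rfl

lemma infAut_sub_form {c : GerbeCocycle E U} (a b : InfAut c) (α : ι) :
    (a - b).1.2.1 α = a.1.2.1 α - b.1.2.1 α := rfl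

lemma infAut_sub_fn {c : GerbeCocycle E U} (a b : InfAut c) (α β : ι) :
    (a - b).1.2.2 α β = a.1.2.2 α β - b.1.2.2 α β := rfl

lemma infAut_neg_form {c : GerbeCocycle E U} (a : InfAut c) (α : ι) :
    (-a).1.2.1 α = -a.1.2.1 α := rfl

lemma infAut_neg_fn {c : GerbeCocycle E U} (a : InfAut c) (α β : ι) :
    (-a).1.2.2 α β = -a.1.2.2 α β := rfl

lemma infAutBr_skew (c : GerbeCocycle E U) (a b : InfAut c) :
    infAutBr c a b = -infAutBr c b a := by
  refine infAut_ext (bracket_skew _ _) (fun α => ?_) fun α β => ?_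
  · rw [infAut_neg_form, infAutBr_form, infAutBr_form, neg_sub]
  · rw [infAut_neg_fn, infAutBr_fn, infAutBr_fn, neg_sub]

lemma infAutBr_isLinear (c : GerbeCocycle E U) (a : InfAut c) : IsLinearMap ℝ (infAutBr c a) where
  map_add b b' := by
    refine infAut_ext (map_add (bracketₗ a.1.1) b.1.1 b'.1.1) (fun α => ?_) fun α β => ?_
    · simp only [infAut_add_form, infAutBr_form, infAut_add_fst, map_add, LinearMap.add_apply]
      abel
    · simp only [infAut_add_fn, infAutBr_fn, infAut_add_fst, map_add, LinearMap.add_apply]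
      abel
  map_smul r b := by
    refine infAut_ext (map_smul (bracketₗ a.1.1) r b.1.1) (fun α => ?_) fun α β => ?_
    · simp only [infAut_smul_form, infAutBr_form, infAut_smul_fst, map_smul, LinearMap.smul_apply,
        smul_sub]
    · simp only [infAut_smul_fn, infAutBr_fn, infAut_smul_fst, map_smul, LinearMap.smul_apply,
        smul_sub]

/-- Contracting the gluing condition of a line bundle with connection with a vector field. -/
lemma contractₗ_glue (X : VF E M) (a : LineBundle E U) (α β : ι) :
    restrₗ inf_le_left (contractₗ X (a.1.1 α)) =
      restrₗ inf_le_right (contractₗ X (a.1.1 β)) + actₗ X (a.1.2 α β) := by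
  refine fn_ext fun x hx => ?_
  have h1 := res_val inf_le_left (contract X (a.1.1 α)) hx
  have h2 := res_val inf_le_right (contract X (a.1.1 β)) hx
  have h3 := congrArg (fun t : Covec E x => (t (X x) : ℝ)) (a.2.1 α β x hx)
  have key : ∀ p q r s t : ℝ, p = r → q = s → r - s = t → p = q + t := by intros; linarith
  exact key _ _ _ _ _ h1 h2 h3

lemma gaugeDₗ_act (X : VF E M) (ε : Gauge E U) :
    (∀ α, (gaugeDₗ fun α => actₗ X (ε α)).1.1 α = lieₗ X ((gaugeDₗ ε).1.1 α)) ∧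
      ∀ α β, (gaugeDₗ fun α => actₗ X (ε α)).1.2 α β = actₗ X ((gaugeDₗ ε).1.2 α β) := by
  refine ⟨fun α => ?_, fun α β => ?_⟩
  · rw [gaugeDₗ_form, gaugeDₗ_form, lieₗ_difₗ]
  · rw [gaugeDₗ_fn, gaugeDₗ_fn, map_sub, actₗ_restrₗ, actₗ_restrₗ]

lemma atiyah_isLie (c : GerbeCocycle E U) : (atiyah c).IsLie where
  del_lin := ((incl c).comp gaugeDₗ).isLinear
  br_lin := infAutBr_isLinear c
  br_skew := infAutBr_skew c
  brW_lin_left ε :=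
    { map_add := fun a b => funext fun α => act_add_left a.1.1 b.1.1 (ε α)
      map_smul := fun r a => funext fun α => act_smul_left r a.1.1 (ε α) }
  brW_lin_right a :=
    { map_add := fun ε ε' => funext fun α => act_add_right a.1.1 (ε α) (ε' α)
      map_smul := fun r ε => funext fun α => act_smul_right a.1.1 r (ε α) }
  ter_lin _ _ := (0 : InfAut c →ₗ[ℝ] Gauge E U).isLinear
  ter_skew₁ _ _ _ := neg_zero.symm
  ter_skew₂ _ _ _ := neg_zero.symm
  del_brW a ε := by
    refine infAut_ext (map_zero (bracketₗ a.1.1)).symm (fun α => ?_) fun α β => ?_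
    · refine ((gaugeDₗ_act a.1.1 ε).1 α).trans ?_
      change _ = (infAutBr c a (incl c (gaugeDₗ ε))).1.2.1 α
      simp [infAutBr_form, incl_fst, incl_form]
    · refine ((gaugeDₗ_act a.1.1 ε).2 α β).trans ?_
      change _ = (infAutBr c a (incl c (gaugeDₗ ε))).1.2.2 α β
      simp [infAutBr_fn, incl_fst, incl_fn]
  brW_del ε ε' := by
    funext α
    change actₗ (0 : VF E M) (ε' α) = -actₗ (0 : VF E M) (ε α)
    simp
  jacobi a b d := by
    refine Eq.trans ?_ (map_zero ((incl c).comp gaugeDₗ)).symm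
    refine infAut_ext (bracket_jacobi _ _ _) (fun α => ?_) fun α β => ?_
    · change (infAutBr c (infAutBr c a b) d + infAutBr c (infAutBr c b d) a +
        infAutBr c (infAutBr c d a) b).1.2.1 α = 0
      simp only [infAut_add_form, infAutBr_form, infAutBr_fst, lieₗ_bracketₗ, map_sub]
      abel
    · change (infAutBr c (infAutBr c a b) d + infAutBr c (infAutBr c b d) a +
        infAutBr c (infAutBr c d a) b).1.2.2 α β = 0
      simp only [infAut_add_fn, infAutBr_fn, infAutBr_fst, actₗ_bracketₗ, map_sub]
      abel
  jacobiW a b ε := by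
    funext α
    change actₗ (bracketₗ a.1.1 b.1.1) (ε α) - actₗ a.1.1 (actₗ b.1.1 (ε α)) +
      actₗ b.1.1 (actₗ a.1.1 (ε α)) = 0
    rw [actₗ_bracketₗ]
    abel
  coherence a b d e := by
    have h : ∀ f : InfAut c, (atiyah c).brW f 0 = 0 := fun f =>
      funext fun α => map_zero (actₗ f.1.1)
    change (atiyah c).brW a 0 - (atiyah c).brW b 0 + (atiyah c).brW d 0 - (atiyah c).brW e 0 =
      (0 - 0 + 0 + 0 - 0 + 0 : Gauge E U)
    simp only [h, sub_self, add_zero]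

lemma incl_isHom (c : GerbeCocycle E U) :
    (lineBundles E U).IsHom (atiyah c) (incl c) LinearMap.id (fun _ _ => 0) := by
  have h0 : (atiyah c).del 0 = 0 := map_zero ((incl c).comp gaugeDₗ)
  have h1 : ∀ a ε, (atiyah c).brW (incl c a) ε = 0 := fun a ε => funext fun α => by
    change actₗ (0 : VF E M) (ε α) = 0
    simp
  exact {
    lin := fun _ => (0 : LineBundle E U →ₗ[ℝ] Gauge E U).isLinear
    skew := fun _ _ => neg_zero.symm
    chain := fun _ => rfl
    map_br := fun a b => by
      rw [h0]
      change incl c 0 - infAutBr c (incl c a) (incl c b) = 0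
      refine infAut_ext ?_ (fun α => ?_) fun α β => ?_
      · simp [infAutBr_fst, incl_fst]
      · simp only [map_zero, infAut_sub_form, infAutBr_form, incl_fst, LinearMap.zero_apply]
        simp
      · simp only [map_zero, infAut_sub_fn, infAutBr_fn, incl_fst, LinearMap.zero_apply]
        simp
    map_brW := fun a ε => by
      rw [h1]
      exact sub_self _
    map_ter := fun a b d => by
      simp only [h1]
      change (0 - 0 : Gauge E U) = _
      abel }

lemma anchor_isHom (c : GerbeCocycle E U) :
    (atiyah c).IsHom (vectorFields E M) (anchor c) 0 (fun _ _ => 0) where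
  lin _ := ⟨fun _ _ => rfl, fun _ _ => rfl⟩
  skew _ _ := rfl
  chain _ := rfl
  map_br _ _ := sub_self _
  map_brW _ _ := rfl
  map_ter _ _ _ := rfl

lemma incl_injective (c : GerbeCocycle E U) : Function.Injective (incl c) := fun _ _ h =>
  Subtype.ext (congrArg (fun a : InfAut c => a.1.2) h)

lemma incl_range (c : GerbeCocycle E U) :
    LinearMap.range (incl c) = LinearMap.ker (anchor c) := by
  refine le_antisymm ?_ fun a ha => ?_
  · rintro _ ⟨a, rfl⟩
    rfl
  · have h0 : a.1.1 = 0 := ha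
    have hl : ∀ {V : Opens M} (θ : Form E V) x, (lie a.1.1 θ).1 x = 0 := fun {V} θ x => by
      rw [← lieₗ_apply, h0, map_zero]; rfl
    have ha' : ∀ {V : Opens M} (f : Fn E V) x, (act a.1.1 f).1 x = 0 := fun {V} f x => by
      rw [← actₗ_apply, h0, map_zero]; rfl
    refine ⟨⟨a.1.2, fun α β x hx => ?_, fun α β γ x hx => ?_⟩,
      Subtype.ext (Prod.ext h0.symm rfl)⟩
    · rw [a.2.1 α β x hx, hl, neg_zero, zero_add]
    · rw [a.2.2 α β γ x hx, ha']

end LieTwoAlgebras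

/-! ### The standard Courant 2-algebra -/

section StandardCourant

variable {E : Type*} [NormedAddCommGroup E] [NormedSpace ℝ E] [FiniteDimensional ℝ E]
  {M : Type*} [TopologicalSpace M] [ChartedSpace E M] [IsManifold 𝓘(ℝ, E) ∞ M]
  {ι : Type*} {U : ι → Opens M}

lemma vfLineBundle_ext {u v : VF E M × LineBundle E U} (h : u.1 = v.1)
    (h1 : ∀ α, u.2.1.1 α = v.2.1.1 α) (h2 : ∀ α β, u.2.1.2 α β = v.2.1.2 α β) : u = v :=
  Prod.ext h (lineBundle_ext h1 h2)

lemma courantBr_fst (u v : VF E M × LineBundle E U) :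
    (courantBr u v).1 = bracketₗ u.1 v.1 := rfl

lemma courantBr_form (u v : VF E M × LineBundle E U) (α : ι) :
    (courantBr u v).2.1.1 α = lieₗ u.1 (v.2.1.1 α) - lieₗ v.1 (u.2.1.1 α)
      - (1 / 2 : ℝ) • difₗ (contractₗ u.1 (v.2.1.1 α) - contractₗ v.1 (u.2.1.1 α)) := rfl

lemma courantBr_fn (u v : VF E M × LineBundle E U) (α β : ι) :
    (courantBr u v).2.1.2 α β =
      (1 / 2 : ℝ) • actₗ u.1 (v.2.1.2 α β) - (1 / 2 : ℝ) • actₗ v.1 (u.2.1.2 α β) := rfl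

lemma lineBundle_add_form (a b : LineBundle E U) (α : ι) :
    (a + b).1.1 α = a.1.1 α + b.1.1 α := rfl

lemma lineBundle_add_fn (a b : LineBundle E U) (α β : ι) :
    (a + b).1.2 α β = a.1.2 α β + b.1.2 α β := rfl

lemma lineBundle_smul_form (r : ℝ) (a : LineBundle E U) (α : ι) :
    (r • a).1.1 α = r • a.1.1 α := rfl

lemma lineBundle_smul_fn (r : ℝ) (a : LineBundle E U) (α β : ι) :
    (r • a).1.2 α β = r • a.1.2 α β := rfl

lemma lineBundle_neg_form (a : LineBundle E U) (α : ι) : (-a).1.1 α = -a.1.1 α := rfl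

lemma lineBundle_neg_fn (a : LineBundle E U) (α β : ι) : (-a).1.2 α β = -a.1.2 α β := rfl

/-- The function `ι_X L_Y ζ - ι_Y L_X ζ`, whose cyclic sum is four times the ternary bracket. It is
expanded by `ι_Y L_X = X ι_Y - ι_[X,Y]`, so that only functions are differentiated. -/
noncomputable def courantAlt {V : Opens M} (X Y : VF E M) : Form E V →ₗ[ℝ] Fn E V :=
  actₗ Y ∘ₗ contractₗ X - actₗ X ∘ₗ contractₗ Y + (2 : ℝ) • contractₗ (bracketₗ X Y)

lemma courantAlt_apply {V : Opens M} (X Y : VF E M) (ζ : Form E V) : courantAlt X Y ζ =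
    actₗ Y (contractₗ X ζ) - actₗ X (contractₗ Y ζ) + (2 : ℝ) • contractₗ (bracketₗ X Y) ζ := rfl

lemma bracketₗ_skew (X Y : VF E M) : bracketₗ X Y = -bracketₗ Y X := bracket_skew X Y

lemma courantTri_sub {V : Opens M} (X Y : VF E M) (ζ : Form E V) :
    courantTri X Y ζ - courantTri Y X ζ = courantAlt X Y ζ := by
  rw [courantTri_eq, courantTri_eq, courantAlt_apply, bracketₗ_skew Y X, map_neg,
    LinearMap.neg_apply]
  module

/-- The ternary Courant bracket, written with `courantAlt`. -/
lemma standardCourant_ter (u v w : VF E M × LineBundle E U) (α : ι) :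
    (standardCourant E U).ter u v w α = (1 / 4 : ℝ) • (courantAlt u.1 v.1 (w.2.1.1 α)
      + courantAlt v.1 w.1 (u.2.1.1 α) + courantAlt w.1 u.1 (v.2.1.1 α)) := by
  rw [← courantTri_sub, ← courantTri_sub, ← courantTri_sub]
  change (1 / 4 : ℝ) • (courantTri u.1 v.1 (w.2.1.1 α) - courantTri v.1 u.1 (w.2.1.1 α)
      + courantTri v.1 w.1 (u.2.1.1 α) - courantTri w.1 v.1 (u.2.1.1 α)
      + courantTri w.1 u.1 (v.2.1.1 α) - courantTri u.1 w.1 (v.2.1.1 α)) = _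
  congr 1
  abel

lemma courantAlt_skew {V : Opens M} (X Y : VF E M) (ζ : Form E V) :
    courantAlt X Y ζ = -courantAlt Y X ζ := by
  rw [← courantTri_sub, ← courantTri_sub, neg_sub]

lemma courantAlt_add_left {V : Opens M} (X X' Y : VF E M) (ζ : Form E V) :
    courantAlt (X + X') Y ζ = courantAlt X Y ζ + courantAlt X' Y ζ := by
  simp only [courantAlt_apply, map_add, LinearMap.add_apply]
  module

lemma courantAlt_smul_left {V : Opens M} (r : ℝ) (X Y : VF E M) (ζ : Form E V) :
    courantAlt (r • X) Y ζ = r • courantAlt X Y ζ := by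
  simp only [courantAlt_apply, map_smul, LinearMap.smul_apply]
  module

lemma courantAlt_add_right {V : Opens M} (X Y Y' : VF E M) (ζ : Form E V) :
    courantAlt X (Y + Y') ζ = courantAlt X Y ζ + courantAlt X Y' ζ := by
  rw [courantAlt_skew, courantAlt_add_left, courantAlt_skew Y, courantAlt_skew Y']
  abel

lemma courantAlt_smul_right {V : Opens M} (r : ℝ) (X Y : VF E M) (ζ : Form E V) :
    courantAlt X (r • Y) ζ = r • courantAlt X Y ζ := by
  rw [courantAlt_skew, courantAlt_smul_left, courantAlt_skew Y]
  module

/-- The 1-form `L_X ζ - ½ d ι_X ζ`: the Courant bracket of a vector field with a 1-form. -/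
noncomputable def courantLie {V : Opens M} (X : VF E M) : Form E V →ₗ[ℝ] Form E V :=
  lieₗ X - (1 / 2 : ℝ) • (difₗ ∘ₗ contractₗ X)

lemma courantLie_apply {V : Opens M} (X : VF E M) (ζ : Form E V) :
    courantLie X ζ = lieₗ X ζ - (1 / 2 : ℝ) • difₗ (contractₗ X ζ) := rfl

lemma courantBr_form_courantLie (u v : VF E M × LineBundle E U) (α : ι) :
    (courantBr u v).2.1.1 α = courantLie u.1 (v.2.1.1 α) - courantLie v.1 (u.2.1.1 α) := by
  rw [courantBr_form, courantLie_apply, courantLie_apply, map_sub]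
  module

/-- The failure of `courantLie` to be an action of vector fields is exact; this is the Jacobi
identity of the Courant bracket, up to the differential of the ternary bracket. -/
lemma courantLie_bracket {V : Opens M} (X Y : VF E M) (ζ : Form E V) :
    courantLie (bracketₗ X Y) ζ - courantLie X (courantLie Y ζ) + courantLie Y (courantLie X ζ) =
      (1 / 4 : ℝ) • difₗ (courantAlt X Y ζ) := by
  simp only [courantLie_apply, courantAlt_apply, lieₗ_bracketₗ, map_sub, map_add, map_smul,
    contractₗ_lieₗ, lieₗ_difₗ, contractₗ_difₗ, bracketₗ_skew Y X, map_neg, LinearMap.neg_apply]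
  module

/-- The part of the coherence law of the standard Courant 2-algebra that involves only one of the
four 1-forms. -/
lemma courantAlt_coherence {V : Opens M} (X Y Z : VF E M) (ζ : Form E V) :
    (1 / 2 : ℝ) • (actₗ X (courantAlt Y Z ζ) - actₗ Y (courantAlt X Z ζ)
        + actₗ Z (courantAlt X Y ζ)) =
      courantAlt (bracketₗ X Y) Z ζ - courantAlt (bracketₗ X Z) Y ζ
        + courantAlt (bracketₗ Y Z) X ζ + courantAlt Y Z (courantLie X ζ)
        - courantAlt X Z (courantLie Y ζ) + courantAlt X Y (courantLie Z ζ) := by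
  have hj : bracketₗ (bracketₗ Y Z) X = bracketₗ (bracketₗ X Z) Y - bracketₗ (bracketₗ X Y) Z := by
    have h := bracket_jacobi X Y Z
    have h' : bracketₗ (bracketₗ X Y) Z + bracketₗ (bracketₗ Y Z) X + bracketₗ (bracketₗ Z X) Y = 0 :=
      h
    rw [bracketₗ_skew Z X, map_neg, LinearMap.neg_apply] at h'
    rw [← sub_eq_zero, ← h']
    abel
  -- Everything is expressed through second derivatives of contractions of `ζ` and contractions with
  -- iterated brackets, whose order is normalised by skewness and the Jacobi identity `hj`.
  simp only [courantAlt_apply, courantLie_apply, map_sub, map_add, map_smul, contractₗ_lieₗ,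
    contractₗ_difₗ, actₗ_bracketₗ, hj, LinearMap.sub_apply, bracketₗ_skew Y X,
    bracketₗ_skew Z X, bracketₗ_skew Z Y, bracketₗ_skew X (bracketₗ Y Z),
    bracketₗ_skew Y (bracketₗ X Z), bracketₗ_skew Z (bracketₗ X Y), map_neg, LinearMap.neg_apply]
  module

/-- On an overlap `courantAlt` of the local 1-forms of a line bundle jumps by the commutator of the
derivatives of the transition function. -/
lemma courantAlt_glue (X Y : VF E M) (a : LineBundle E U) (α β : ι) :
    restrₗ inf_le_left (courantAlt X Y (a.1.1 α)) - restrₗ inf_le_right (courantAlt X Y (a.1.1 β)) =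
      actₗ (bracketₗ X Y) (a.1.2 α β) := by
  simp only [courantAlt_apply, map_add, map_sub, map_smul, ← actₗ_restrₗ, contractₗ_glue,
    actₗ_bracketₗ]
  module

lemma standardCourant_del (ε : Gauge E U) : (standardCourant E U).del ε = (0, gaugeDₗ ε) := rfl

lemma standardCourant_brW (u : VF E M × LineBundle E U) (ε : Gauge E U) (α : ι) :
    (standardCourant E U).brW u ε α = (1 / 2 : ℝ) • actₗ u.1 (ε α) := rfl

lemma standardCourant_br (u v : VF E M × LineBundle E U) :
    (standardCourant E U).br u v = courantBr u v := rfl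

lemma standardCourant_isLie : (standardCourant E U).IsLie where
  del_lin := ((LinearMap.inr ℝ (VF E M) (LineBundle E U)).comp gaugeDₗ).isLinear
  br_lin u :=
    { map_add := fun v w => by
        simp only [standardCourant_br]
        refine vfLineBundle_ext (map_add (bracketₗ u.1) v.1 w.1) (fun α => ?_) fun α β => ?_
        · simp only [Prod.snd_add, Prod.fst_add, lineBundle_add_form, courantBr_form, map_add,
            map_sub, LinearMap.add_apply]
          module
        · simp only [Prod.snd_add, Prod.fst_add, lineBundle_add_fn, courantBr_fn, map_add,
            LinearMap.add_apply]
          module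
      map_smul := fun r v => by
        simp only [standardCourant_br]
        refine vfLineBundle_ext (map_smul (bracketₗ u.1) r v.1) (fun α => ?_) fun α β => ?_
        · simp only [Prod.smul_snd, Prod.smul_fst, lineBundle_smul_form, courantBr_form, map_smul,
            map_sub, LinearMap.smul_apply]
          module
        · simp only [Prod.smul_snd, Prod.smul_fst, lineBundle_smul_fn, courantBr_fn, map_smul,
            LinearMap.smul_apply]
          module }
  br_skew u v := by
    simp only [standardCourant_br]
    refine vfLineBundle_ext (bracketₗ_skew u.1 v.1) (fun α => ?_) fun α β => ?_
    · rw [Prod.snd_neg, lineBundle_neg_form, courantBr_form_courantLie, courantBr_form_courantLie, neg_sub]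
    · rw [Prod.snd_neg, lineBundle_neg_fn, courantBr_fn, courantBr_fn, neg_sub]
  brW_lin_left ε :=
    { map_add := fun u v => funext fun α => by
        simp only [standardCourant_brW, Pi.add_apply, Prod.fst_add, map_add, LinearMap.add_apply,
          smul_add]
      map_smul := fun r u => funext fun α => by
        simp only [standardCourant_brW, Pi.smul_apply, Prod.smul_fst, map_smul,
          LinearMap.smul_apply]
        module }
  brW_lin_right u :=
    { map_add := fun ε ε' => funext fun α => by
        simp only [standardCourant_brW, Pi.add_apply, map_add, smul_add]
      map_smul := fun r u => funext fun α => by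
        simp only [standardCourant_brW, Pi.smul_apply, map_smul]
        module }
  ter_lin u v :=
    { map_add := fun w w' => funext fun α => by
        simp only [standardCourant_ter, Pi.add_apply, Prod.fst_add, Prod.snd_add,
          lineBundle_add_form, map_add, courantAlt_add_left, courantAlt_add_right]
        module
      map_smul := fun r w => funext fun α => by
        simp only [standardCourant_ter, Pi.smul_apply, Prod.smul_fst, Prod.smul_snd,
          lineBundle_smul_form, map_smul, courantAlt_smul_left, courantAlt_smul_right]
        module }
  ter_skew₁ u v w := funext fun α => by
    simp only [standardCourant_ter, Pi.neg_apply]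
    rw [courantAlt_skew v.1 u.1, courantAlt_skew u.1 w.1, courantAlt_skew w.1 v.1]
    module
  ter_skew₂ u v w := funext fun α => by
    simp only [standardCourant_ter, Pi.neg_apply]
    rw [courantAlt_skew v.1 u.1, courantAlt_skew u.1 w.1, courantAlt_skew w.1 v.1]
    module
  del_brW u ε := by
    rw [standardCourant_br, standardCourant_del, standardCourant_del]
    refine vfLineBundle_ext (map_zero (bracketₗ u.1)).symm (fun α => ?_) fun α β => ?_
    · rw [courantBr_form]
      simp only [gaugeDₗ_form, standardCourant_brW, map_zero, LinearMap.zero_apply, map_smul,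
        lieₗ_difₗ, contractₗ_difₗ, sub_zero]
      module
    · rw [courantBr_fn]
      simp only [gaugeDₗ_fn, standardCourant_brW, map_zero, LinearMap.zero_apply, map_smul,
        map_sub, actₗ_restrₗ]
      module
  brW_del ε ε' := funext fun α => by
    simp only [standardCourant_del, standardCourant_brW, Pi.neg_apply, map_zero,
      LinearMap.zero_apply, smul_zero, neg_zero]
  jacobi u v w := by
    simp only [standardCourant_br, standardCourant_del]
    refine vfLineBundle_ext (bracket_jacobi u.1 v.1 w.1) (fun α => ?_) fun α β => ?_
    · simp only [Prod.snd_add, lineBundle_add_form, gaugeDₗ_form, standardCourant_ter, map_smul,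
        map_add, smul_add, ← courantLie_bracket, courantBr_form_courantLie, courantBr_fst, map_sub]
      abel
    · have h : (gaugeDₗ ((standardCourant E U).ter u v w)).1.2 α β = (1 / 4 : ℝ) •
          (actₗ (bracketₗ u.1 v.1) (w.2.1.2 α β) + actₗ (bracketₗ v.1 w.1) (u.2.1.2 α β)
            + actₗ (bracketₗ w.1 u.1) (v.2.1.2 α β)) := by
        simp only [gaugeDₗ_fn, standardCourant_ter, map_smul, map_add, ← courantAlt_glue]
        module
      rw [h]
      simp only [Prod.snd_add, lineBundle_add_fn, courantBr_fn, courantBr_fst, map_sub, map_smul,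
        actₗ_bracketₗ]
      module
  jacobiW u v ε := funext fun α => by
    simp only [standardCourant_br, standardCourant_del, standardCourant_ter, standardCourant_brW,
      Pi.add_apply, Pi.sub_apply, courantBr_fst, actₗ_bracketₗ, gaugeDₗ_form, courantAlt_apply,
      contractₗ_difₗ, map_zero, LinearMap.zero_apply, map_smul]
    module
  coherence x y z w := funext fun α => by
    -- Both sides are additive in the 1-forms of the four arguments; the signs below are those of
    -- the permutations that move the argument contributing its 1-form to the last place.
    have h1 := courantAlt_coherence x.1 y.1 z.1 (w.2.1.1 α)
    have h2 := courantAlt_coherence x.1 y.1 w.1 (z.2.1.1 α)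
    have h3 := courantAlt_coherence x.1 z.1 w.1 (y.2.1.1 α)
    have h4 := courantAlt_coherence y.1 z.1 w.1 (x.2.1.1 α)
    simp only [Pi.add_apply, Pi.sub_apply, standardCourant_br, standardCourant_ter,
      standardCourant_brW, courantBr_form_courantLie, courantBr_fst, map_add, map_sub, map_smul]
    simp only [courantAlt_skew z.1 x.1, courantAlt_skew w.1 x.1, courantAlt_skew w.1 y.1,
      courantAlt_skew z.1 (bracketₗ _ _), courantAlt_skew y.1 (bracketₗ _ _),
      courantAlt_skew w.1 (bracketₗ _ _), map_neg]
    linear_combination (norm := module) (1 / 4 : ℝ) • h1 - (1 / 4 : ℝ) • h2 + (1 / 4 : ℝ) • h3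
      - (1 / 4 : ℝ) • h4

end StandardCourant

/-! ### Lifting vector fields to infinitesimal automorphisms -/

section Surjectivity

variable {E : Type*} [NormedAddCommGroup E] [NormedSpace ℝ E] [FiniteDimensional ℝ E]
  {M : Type*} [TopologicalSpace M] [ChartedSpace E M] [IsManifold 𝓘(ℝ, E) ∞ M]
  {ι : Type*} {U : ι → Opens M}

/-- Restriction of 1-forms as a linear map. -/
noncomputable def restrFormₗ {V W : Opens M} (h : V ≤ W) : Form E W →ₗ[ℝ] Form E V where
  toFun := restrForm h
  map_add' θ θ' := form_ext fun x hx => by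
    rw [Form.add_val, restrForm_val h _ hx, restrForm_val h _ hx, restrForm_val h _ hx,
      Form.add_val]
  map_smul' r θ := form_ext fun x hx => by
    refine (restrForm_val h _ hx).trans ?_
    exact (congrArg (r • ·) (restrForm_val h θ hx)).symm

lemma restrFormₗ_val {V W : Opens M} (h : V ≤ W) (θ : Form E W) {x : M} (hx : x ∈ V) :
    (restrFormₗ h θ).1 x = θ.1 x := restrForm_val h θ hx

lemma restrₗ_val {V W : Opens M} (h : V ≤ W) (f : Fn E W) {x : M} (hx : x ∈ V) :
    (restrₗ h f).1 x = f.1 x := res_val h f hx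

lemma lieₗ_restrFormₗ (X : VF E M) {V W : Opens M} (h : V ≤ W) (θ : Form E W) :
    lieₗ X (restrFormₗ h θ) = restrFormₗ h (lieₗ X θ) :=
  form_ext fun _ hx => (lie_restr X h θ hx).trans (restrForm_val h _ hx).symm

lemma difₗ_restrₗ {V W : Opens M} (h : V ≤ W) (f : Fn E W) :
    difₗ (restrₗ h f) = restrFormₗ h (difₗ f) := by
  refine form_ext fun x hx => (d_val _ hx).trans (Eq.trans ?_ (restrForm_val h _ hx).symm)
  refine Eq.trans (dFun_congr ?_) (d_val f (h hx)).symm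
  filter_upwards [V.isOpen.mem_nhds hx] with m hm
  exact res_val h f hm

/-- The function `Σ_δ ρ_δ f_δ` on `V`, for `f_δ` defined on `V ∩ U_δ`. It is smooth on all of `V`
because `ρ_δ` is supported in `U_δ`. -/
noncomputable def glueFn {ρ : SmoothPartitionOfUnity ι 𝓘(ℝ, E) M Set.univ}
    (hρ : ρ.IsSubordinate fun α => (U α : Set M)) (V : Opens M)
    (f : ∀ δ, Fn E (V ⊓ U δ)) : Fn E V :=
  ⟨fun x => ∑ᶠ δ, ρ δ x • (f δ).1 x,
    fun x hx => ρ.contMDiffAt_finsum fun δ hδ => (f δ).2.1 x ⟨hx, hρ δ hδ⟩,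
    fun x hx => by
      have h : ∀ δ, (f δ).1 x = 0 := fun δ => (f δ).2.2 x fun hh => hx hh.1
      simp [h]⟩

lemma coframe_finsum_smul (ρ : SmoothPartitionOfUnity ι 𝓘(ℝ, E) M Set.univ)
    (θ : ι → ∀ x : M, Covec E x) (x m : M) :
    coframe (fun m => ∑ᶠ δ, ρ δ m • θ δ m) x m = ∑ᶠ δ, ρ δ m • coframe (θ δ) x m := by
  have h : (coframe (fun m => ∑ᶠ δ, ρ δ m • θ δ m) x m) =
      (∑ᶠ δ, ρ δ m • θ δ m).comp ((trivializationAt E (TangentSpace 𝓘(ℝ, E)) x).symmL ℝ m) := rfl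
  rw [h, ← ρ.sum_finsupport_smul_eq_finsum m (fun δ m => coframe (θ δ) x m),
    ← ρ.sum_finsupport_smul_eq_finsum (A := TangentSpace 𝓘(ℝ, E) m →L[ℝ] ℝ) m
      (fun δ _ => θ δ m)]
  ext v
  simp [coframe]

/-- The 1-form `Σ_δ ρ_δ θ_δ` on `V`, for `θ_δ` defined on `V ∩ U_δ`; the analogue of `glueFn`. -/
noncomputable def glueForm {ρ : SmoothPartitionOfUnity ι 𝓘(ℝ, E) M Set.univ}
    (hρ : ρ.IsSubordinate fun α => (U α : Set M)) (V : Opens M)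
    (θ : ∀ δ, Form E (V ⊓ U δ)) : Form E V :=
  ⟨fun x => ∑ᶠ δ, ρ δ x • (θ δ).1 x,
    fun x hx => by
      rw [smoothCovecAt_iff]
      have h : coframe (fun m => ∑ᶠ δ, ρ δ m • (θ δ).1 m) x =
          fun m => ∑ᶠ δ, ρ δ m • coframe (θ δ).1 x m :=
        funext fun m => coframe_finsum_smul ρ (fun δ => (θ δ).1) x m
      rw [h]
      exact ρ.contMDiffAt_finsum fun δ hδ =>
        smoothCovecAt_iff.1 ((θ δ).2.1 x ⟨hx, hρ δ hδ⟩),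
    fun x hx => by
      have h : ∀ δ, (θ δ).1 x = 0 := fun δ => (θ δ).2.2 x fun hh => hx hh.1
      simp [h]⟩

lemma finsum_smul_eq_of_forall {A : Type*} [AddCommGroup A] [Module ℝ A]
    (ρ : SmoothPartitionOfUnity ι 𝓘(ℝ, E) M Set.univ) (x : M) (φ : ι → A) (a : A)
    (h : ∀ δ, x ∈ tsupport (ρ δ) → φ δ = a) : ∑ᶠ δ, ρ δ x • φ δ = a := by
  rw [← ρ.sum_finsupport_smul_eq_finsum x (fun δ _ => φ δ)]
  have h1 : ∀ δ ∈ ρ.finsupport x, ρ δ x • φ δ = ρ δ x • a := fun δ hδ => by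
    rw [h δ (subset_tsupport _ ((ρ.mem_finsupport x).1 hδ))]
  rw [Finset.sum_congr rfl h1, ← Finset.sum_smul, ρ.sum_finsupport x (Set.mem_univ x), one_smul]

lemma finsum_smul_add {A : Type*} [AddCommGroup A] [Module ℝ A]
    (ρ : SmoothPartitionOfUnity ι 𝓘(ℝ, E) M Set.univ) (x : M) (φ ψ : ι → A) :
    ∑ᶠ δ, ρ δ x • φ δ + ∑ᶠ δ, ρ δ x • ψ δ = ∑ᶠ δ, ρ δ x • (φ δ + ψ δ) := by
  rw [← ρ.sum_finsupport_smul_eq_finsum x (fun δ _ => φ δ),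
    ← ρ.sum_finsupport_smul_eq_finsum x (fun δ _ => ψ δ),
    ← ρ.sum_finsupport_smul_eq_finsum x (fun δ _ => φ δ + ψ δ),
    ← Finset.sum_add_distrib]
  simp only [smul_add]

lemma finsum_smul_sub {A : Type*} [AddCommGroup A] [Module ℝ A]
    (ρ : SmoothPartitionOfUnity ι 𝓘(ℝ, E) M Set.univ) (x : M) (φ ψ : ι → A) :
    ∑ᶠ δ, ρ δ x • φ δ - ∑ᶠ δ, ρ δ x • ψ δ = ∑ᶠ δ, ρ δ x • (φ δ - ψ δ) := by
  rw [sub_eq_iff_eq_add, finsum_smul_add]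
  simp only [sub_add_cancel]

/-- A continuous function with values in `2πℤ` is locally constant, so its differential vanishes. -/
lemma dFun_eq_zero_of_two_pi_int {g : M → ℝ} {x : M} (hg : ContinuousAt g x)
    (h : ∀ᶠ m in 𝓝 x, ∃ n : ℤ, g m = 2 * Real.pi * n) : dFun (E := E) g x = 0 := by
  have hpi := Real.pi_pos
  obtain ⟨n₀, h₀⟩ := h.self_of_nhds
  have hc : g =ᶠ[𝓝 x] fun _ => g x := by
    filter_upwards [h, Metric.continuousAt_iff'.1 hg (2 * Real.pi) (by positivity)] with m hm hd
    obtain ⟨n, hn⟩ := hm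
    rw [Real.dist_eq, hn, h₀, ← mul_sub, abs_mul, abs_of_pos (by positivity : 0 < 2 * Real.pi),
      mul_lt_iff_lt_one_right (by positivity)] at hd
    have h1 : |n - n₀| < 1 := by exact_mod_cast hd
    rw [Int.abs_lt_one_iff, sub_eq_zero] at h1
    rw [hn, h₀, h1]
  rw [dFun_congr hc]
  exact mfderiv_const

/-- The cocycle condition modulo `2πℤ` of `G` becomes an honest one after differentiation. -/
lemma act_G_cocycle (c : GerbeCocycle E U) (X : VF E M) {α β γ δ : ι} {x : M}
    (hα : x ∈ U α) (hβ : x ∈ U β) (hγ : x ∈ U γ) (hδ : x ∈ U δ) :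
    (act X (c.G α β δ)).1 x + (act X (c.G β γ δ)).1 x + (act X (c.G γ α δ)).1 x =
      (act X (c.G α β γ)).1 x := by
  have sm : ∀ {α β γ}, x ∈ U α → x ∈ U β → x ∈ U γ →
      ContMDiffAt 𝓘(ℝ, E) 𝓘(ℝ, ℝ) ∞ (c.G α β γ).1 x :=
    fun h1 h2 h3 => (c.G _ _ _).2.1 x ⟨⟨h1, h2⟩, h3⟩
  have s1 := sm hα hβ hδ
  have s2 := sm hβ hγ hδ
  have s3 := sm hγ hα hδ
  have s4 := sm hα hβ hγ
  have s12 := s1.add s2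
  have s123 := s12.add s3
  have s4' : ContMDiffAt 𝓘(ℝ, E) 𝓘(ℝ, ℝ) ∞ (fun m => (-1) * (c.G α β γ).1 m) x :=
    contMDiffAt_const.mul s4
  have h0 : dFun (E := E) (fun m => (c.G α β δ).1 m + (c.G β γ δ).1 m + (c.G γ α δ).1 m
      + (-1) * (c.G α β γ).1 m) x = 0 := by
    refine dFun_eq_zero_of_two_pi_int (s123.add s4').continuousAt ?_
    filter_upwards [(U α).isOpen.mem_nhds hα, (U β).isOpen.mem_nhds hβ,
      (U γ).isOpen.mem_nhds hγ, (U δ).isOpen.mem_nhds hδ] with m h1 h2 h3 h4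
    -- By antisymmetry of `G` the function is minus the alternating sum of the cocycle condition.
    obtain ⟨n, hn⟩ := c.G_cocycle α β γ δ m ⟨⟨⟨h1, h2⟩, h3⟩, h4⟩
    refine ⟨-n, ?_⟩
    have e1 := c.G_skew₂ γ α δ m
    have e2 := c.G_skew₁ α δ β m
    have e3 := c.G_skew₂ α β δ m
    push_cast
    linarith
  have h1 := dFun_add (E := E) s123 s4'
  have h2 := dFun_add (E := E) s12 s3
  have h3 := dFun_add (E := E) s1 s2
  have h4 := dFun_smul (E := E) (-1) s4
  have h5 := congrArg (fun t : Covec E x => (t (X x) : ℝ))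
    (h0.symm.trans (h1.trans (congrArg₂ (· + ·) (h2.trans (congrArg (· + _) h3)) h4)))
  have h6 : (0 : ℝ) = dFun (c.G α β δ).1 x (X x) + dFun (c.G β γ δ).1 x (X x)
      + dFun (c.G γ α δ).1 x (X x) + (-1) * dFun (c.G α β γ).1 x (X x) := h5
  rw [act_val X (c.G α β δ) ⟨⟨hα, hβ⟩, hδ⟩, act_val X (c.G β γ δ) ⟨⟨hβ, hγ⟩, hδ⟩,
    act_val X (c.G γ α δ) ⟨⟨hγ, hα⟩, hδ⟩, act_val X (c.G α β γ) ⟨⟨hα, hβ⟩, hγ⟩]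
  linarith

lemma act_G_self (c : GerbeCocycle E U) (X : VF E M) (α β : ι) (x : M) :
    (act X (c.G α β α)).1 x = 0 := by
  have h : c.G α β α = 0 := Subtype.ext (funext fun y => by
    have h1 := c.G_skew₂ α α β y
    have h2 := c.G_skew₁ α α β y
    change (c.G α β α).1 y = 0
    linarith)
  rw [h, ← actₗ_apply, map_zero]
  rfl

/-- A Čech primitive `η` of `X(G)` is antisymmetric. -/
lemma primitive_skew (c : GerbeCocycle E U) (X : VF E M) (η : ∀ α β, Fn E (U α ⊓ U β))
    (h : ∀ α β γ, ∀ x ∈ U α ⊓ U β ⊓ U γ, (η α β).1 x + (η β γ).1 x + (η γ α).1 x =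
      (act X (c.G α β γ)).1 x) {α β : ι} {x : M} (hα : x ∈ U α) (hβ : x ∈ U β) :
    (η β α).1 x = -(η α β).1 x := by
  have h1 := h α α α x ⟨⟨hα, hα⟩, hα⟩
  have h2 := h α β α x ⟨⟨hα, hβ⟩, hα⟩
  rw [act_G_self] at h1 h2
  linarith

/-- If `η` is a Čech primitive of `X(G)`, then the 1-forms `dη_αβ - L_X Λ_αβ` form a cocycle. -/
lemma form_cocycle (c : GerbeCocycle E U) (X : VF E M) (η : ∀ α β, Fn E (U α ⊓ U β))
    (h : ∀ α β γ, ∀ x ∈ U α ⊓ U β ⊓ U γ, (η α β).1 x + (η β γ).1 x + (η γ α).1 x =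
      (act X (c.G α β γ)).1 x) {α β δ : ι} {x : M} (hα : x ∈ U α) (hβ : x ∈ U β) (hδ : x ∈ U δ) :
    (difₗ (η α δ) - lieₗ X (c.Λ α δ)).1 x - (difₗ (η β δ) - lieₗ X (c.Λ β δ)).1 x =
      (difₗ (η α β) - lieₗ X (c.Λ α β)).1 x := by
  have lαβ : U α ⊓ U β ⊓ U δ ≤ U α ⊓ U β := inf_le_left
  have lβδ : U α ⊓ U β ⊓ U δ ≤ U β ⊓ U δ := inf_le_inf_right _ inf_le_right
  have lαδ : U α ⊓ U β ⊓ U δ ≤ U α ⊓ U δ := inf_le_inf_right _ inf_le_left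
  have h1 : restrFormₗ lαβ (c.Λ α β) + restrFormₗ lβδ (c.Λ β δ) - restrFormₗ lαδ (c.Λ α δ) =
      difₗ (c.G α β δ) := form_ext fun y hy => by
    rw [Form.sub_val, Form.add_val, restrFormₗ_val _ _ hy, restrFormₗ_val _ _ hy,
      restrFormₗ_val _ _ hy, difₗ_apply, ← c.Λ_cocycle α β δ y hy, c.Λ_skew α δ, sub_eq_add_neg]
  have h2 : restrₗ lαβ (η α β) + restrₗ lβδ (η β δ) - restrₗ lαδ (η α δ) =
      actₗ X (c.G α β δ) := fn_ext fun y hy => by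
    rw [Fn.sub_val, Fn.add_val, restrₗ_val _ _ hy, restrₗ_val _ _ hy,
      restrₗ_val _ _ hy, actₗ_apply, ← h α β δ y hy, primitive_skew c X η h hy.1.1 hy.2,
      sub_eq_add_neg]
  have h3 := congrArg (lieₗ X) h1
  have h4 := congrArg difₗ h2
  rw [lieₗ_difₗ] at h3
  simp only [map_add, map_sub, lieₗ_restrFormₗ] at h3
  simp only [map_add, map_sub, difₗ_restrₗ] at h4
  have h5 : restrFormₗ lαδ (difₗ (η α δ) - lieₗ X (c.Λ α δ)) -
      restrFormₗ lβδ (difₗ (η β δ) - lieₗ X (c.Λ β δ)) =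
      restrFormₗ lαβ (difₗ (η α β) - lieₗ X (c.Λ α β)) := by
    simp only [map_sub]
    have h6 := h4.trans h3.symm
    rw [← sub_eq_zero] at h6 ⊢
    rw [← neg_eq_zero, ← h6]
    abel
  have hx : x ∈ U α ⊓ U β ⊓ U δ := ⟨⟨hα, hβ⟩, hδ⟩
  have h6 := congrArg (fun θ : Form E (U α ⊓ U β ⊓ U δ) => θ.1 x) h5
  simp only [Form.sub_val] at h6
  rwa [restrFormₗ_val _ _ hx, restrFormₗ_val _ _ hx, restrFormₗ_val _ _ hx] at h6

/-- Every vector field lifts to an infinitesimal automorphism: with a partition of unity `ρ`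
subordinate to the cover, `η_αβ = Σ_δ ρ_δ X(G_αβδ)` and
`ξ_α = Σ_δ ρ_δ (dη_αδ - L_X Λ_αδ)` solve the gluing equations. -/
lemma anchor_surjective [T2Space M] [SigmaCompactSpace M] (hU : ⨆ α, U α = ⊤)
    (c : GerbeCocycle E U) : Function.Surjective (anchor c) := by
  obtain ⟨ρ, hρ⟩ := SmoothPartitionOfUnity.exists_isSubordinate 𝓘(ℝ, E) (s := (Set.univ : Set M))
    isClosed_univ (fun α => (U α : Set M)) (fun α => (U α).isOpen) (fun x _ => by
      have hx : x ∈ ⨆ α, U α := hU ▸ Opens.mem_top x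
      obtain ⟨α, hα⟩ := Opens.mem_iSup.1 hx
      exact Set.mem_iUnion.2 ⟨α, hα⟩)
  intro X
  let η : ∀ α β, Fn E (U α ⊓ U β) := fun α β => glueFn hρ _ fun δ => act X (c.G α β δ)
  have hη : ∀ α β γ, ∀ x ∈ U α ⊓ U β ⊓ U γ, (η α β).1 x + (η β γ).1 x + (η γ α).1 x =
      (act X (c.G α β γ)).1 x := fun α β γ x hx => by
    refine (congrArg (· + (η γ α).1 x) (finsum_smul_add ρ x _ _)).trans ?_
    refine (finsum_smul_add ρ x _ _).trans ?_
    exact finsum_smul_eq_of_forall ρ x _ _ fun δ hδ =>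
      act_G_cocycle c X hx.1.1 hx.1.2 hx.2 (hρ δ hδ)
  let ξ : ∀ α, Form E (U α) := fun α =>
    glueForm hρ _ fun δ => difₗ (η α δ) - lieₗ X (c.Λ α δ)
  refine ⟨⟨(X, ξ, η), fun α β x hx => ?_, hη⟩, rfl⟩
  refine (finsum_smul_sub ρ x (fun δ => (difₗ (η α δ) - lieₗ X (c.Λ α δ)).1 x)
    fun δ => (difₗ (η β δ) - lieₗ X (c.Λ β δ)).1 x).trans ?_
  refine (finsum_smul_eq_of_forall ρ x _ _ fun δ hδ =>
    form_cocycle c X η hη hx.1 hx.2 (hρ δ hδ)).trans ?_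
  rw [Form.sub_val, sub_eq_neg_add]
  rfl

end Surjectivity

/-! ### Transport of Lie 2-algebra structures -/

section Transport

variable {V W V' W' : Type*} [AddCommGroup V] [Module ℝ V] [AddCommGroup W] [Module ℝ W]
  [AddCommGroup V'] [Module ℝ V'] [AddCommGroup W'] [Module ℝ W']

lemma LieTwo.IsLie.transport {L : LieTwo V W} (h : L.IsLie) (e : V ≃ₗ[ℝ] V') :
    (L.transport e).IsLie where
  del_lin := (e.toLinearMap ∘ₗ h.del_lin.mk').isLinear
  br_lin x := (e.toLinearMap ∘ₗ (h.br_lin (e.symm x)).mk' ∘ₗ e.symm.toLinearMap).isLinear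
  br_skew x y := (congrArg e (h.br_skew _ _)).trans (map_neg e _)
  brW_lin_left k := ((h.brW_lin_left k).mk' ∘ₗ e.symm.toLinearMap).isLinear
  brW_lin_right x := h.brW_lin_right (e.symm x)
  ter_lin x y := ((h.ter_lin (e.symm x) (e.symm y)).mk' ∘ₗ e.symm.toLinearMap).isLinear
  ter_skew₁ _ _ _ := h.ter_skew₁ _ _ _
  ter_skew₂ _ _ _ := h.ter_skew₂ _ _ _
  del_brW x k := by simp [LieTwo.transport, h.del_brW]
  brW_del k k' := by simpa [LieTwo.transport] using h.brW_del k k'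
  jacobi x y z := by simp [LieTwo.transport, ← h.jacobi]
  jacobiW x y k := by simpa [LieTwo.transport] using h.jacobiW (e.symm x) (e.symm y) k
  coherence x y z w := by
    simpa [LieTwo.transport] using h.coherence (e.symm x) (e.symm y) (e.symm z) (e.symm w)

lemma LieTwo.IsLie.isHom_transport {L : LieTwo V W} (h : L.IsLie) (e : V ≃ₗ[ℝ] V') :
    L.IsHom (L.transport e) e.toLinearMap LinearMap.id (fun _ _ => 0) where
  lin _ := (0 : V →ₗ[ℝ] W).isLinear
  skew _ _ := neg_zero.symm
  chain _ := rfl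
  map_br x y := by
    have h0 : L.del 0 = 0 := h.del_lin.map_zero
    simp [LieTwo.transport, h0]
  map_brW x k := by simp [LieTwo.transport]
  map_ter x y z := by
    have h0 : ∀ x, L.brW x 0 = 0 := fun x => (h.brW_lin_right x).map_zero
    simp [LieTwo.transport, h0]

lemma LieTwo.IsHom.of_transport {L : LieTwo V W} {L' : LieTwo V' W'} {e : V ≃ₗ[ℝ] V'}
    {φ₁ : W →ₗ[ℝ] W'} {φ₂ : V → V → W'} (h : L.IsHom L' e.toLinearMap φ₁ φ₂) :
    (L.transport e).IsHom L' LinearMap.id φ₁ (fun x y => φ₂ (e.symm x) (e.symm y)) where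
  lin x := ((h.lin (e.symm x)).mk' ∘ₗ e.symm.toLinearMap).isLinear
  skew _ _ := h.skew _ _
  chain := h.chain
  map_br x y := by simpa [LieTwo.transport] using h.map_br (e.symm x) (e.symm y)
  map_brW x k := by simpa [LieTwo.transport] using h.map_brW (e.symm x) k
  map_ter x y z := by simpa [LieTwo.transport] using h.map_ter (e.symm x) (e.symm y) (e.symm z)

end Transport

/-! ### Shifted coordinates on infinitesimal automorphisms -/

section Sections

variable {E : Type*} [NormedAddCommGroup E] [NormedSpace ℝ E] [FiniteDimensional ℝ E]
  {M : Type*} [TopologicalSpace M] [ChartedSpace E M] [IsManifold 𝓘(ℝ, E) ∞ M]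
  {ι : Type*} {U : ι → Opens M}

/-- The gluing conditions of an infinitesimal automorphism in terms of `η_αβ - ι_X Λ_αβ`: the
exact parts of `L_X Λ = ι_X dΛ + d ι_X Λ` and of `ι_X dG` are absorbed by the shift. -/
lemma mem_infAut_iff (c : GerbeCocycle E U) (X : VF E M) (ξ : ∀ α, Form E (U α))
    (η : ∀ α β, Fn E (U α ⊓ U β)) :
    (X, (ξ, η)) ∈ InfAut c ↔
      (∀ α β, ∀ x ∈ U α ⊓ U β, (ξ α).1 x - (ξ β).1 x =
          -(contractD X (c.Λ α β)).1 x + (dif (η α β - contract X (c.Λ α β))).1 x) ∧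
        ∀ α β γ, ∀ x ∈ U α ⊓ U β ⊓ U γ,
          (η α β - contract X (c.Λ α β)).1 x + (η β γ - contract X (c.Λ β γ)).1 x +
            (η γ α - contract X (c.Λ γ α)).1 x = 0 := by
  refine and_congr ?_ ?_
  · refine forall_congr' fun α => forall_congr' fun β => forall_congr' fun x =>
      forall_congr' fun _ => ?_
    have h : -(lie X (c.Λ α β)).1 x + (dif (η α β)).1 x =
        -(contractD X (c.Λ α β)).1 x + (dif (η α β - contract X (c.Λ α β))).1 x := by
      have e : (lie X (c.Λ α β)).1 x =
        (contractD X (c.Λ α β)).1 x + (dif (contract X (c.Λ α β))).1 x := rfl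
      rw [dif_sub, Form.sub_val, e]
      abel
    rw [← h]
  · refine forall_congr' fun α => forall_congr' fun β => forall_congr' fun γ =>
      forall_congr' fun x => forall_congr' fun hx => ?_
    have h : (contract X (c.Λ α β)).1 x + (contract X (c.Λ β γ)).1 x +
        (contract X (c.Λ γ α)).1 x = (act X (c.G α β γ)).1 x :=
      congrArg (fun t : Covec E x => (t (X x) : ℝ)) (c.Λ_cocycle α β γ x hx)
    simp only [Fn.sub_val, ← h]
    constructor <;> intro h' <;> linarith

lemma existsUnique_shifted (c : GerbeCocycle E U) (X : VF E M) (ξ : ∀ α, Form E (U α))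
    (f : ∀ α β, Fn E (U α ⊓ U β)) :
    ((∀ α β, ∀ x ∈ U α ⊓ U β, (ξ α).1 x - (ξ β).1 x =
          -(contractD X (c.Λ α β)).1 x + (dif (f α β)).1 x) ∧
        ∀ α β γ, ∀ x ∈ U α ⊓ U β ⊓ U γ, (f α β).1 x + (f β γ).1 x + (f γ α).1 x = 0) ↔
      ∃! a : InfAut c, a.1.1 = X ∧ a.1.2.1 = ξ ∧ shifted c a = f := by
  constructor
  · intro h
    have hm : (X, (ξ, fun α β => f α β + contract X (c.Λ α β))) ∈ InfAut c := by
      rw [mem_infAut_iff]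
      simpa only [add_sub_cancel_right] using h
    refine ⟨⟨_, hm⟩, ⟨rfl, rfl, ?_⟩, ?_⟩
    · funext α β
      exact add_sub_cancel_right _ _
    · rintro a ⟨h1, h2, h3⟩
      refine infAut_ext h1 (fun α => congrFun h2 α) fun α β => ?_
      have h4 : a.1.2.2 α β - contract a.1.1 (c.Λ α β) = f α β := congrFun (congrFun h3 α) β
      rw [h1] at h4
      exact sub_eq_iff_eq_add.1 h4
  · rintro ⟨a, ⟨rfl, rfl, rfl⟩, -⟩
    exact (mem_infAut_iff c _ _ _).1 a.2

lemma add_del_eq_iff (c : GerbeCocycle E U) (a b : InfAut c) (ε : Gauge E U) :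
    a + (atiyah c).del ε = b ↔
      b.1.1 = a.1.1 ∧ (∀ α, b.1.2.1 α = a.1.2.1 α + dif (ε α)) ∧
        ∀ α β, shifted c b α β = shifted c a α β +
          (restr inf_le_left (ε α) - restr inf_le_right (ε β)) := by
  have e (α β : ι) : (a + (atiyah c).del ε).1.2.2 α β =
    a.1.2.2 α β + (restr inf_le_left (ε α) - restr inf_le_right (ε β)) := rfl
  constructor
  · rintro rfl
    have h : (a + (atiyah c).del ε).1.1 = a.1.1 := add_zero a.1.1
    refine ⟨h, fun _ => rfl, fun α β => ?_⟩
    rw [shifted, shifted, e, h]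
    abel
  · rintro ⟨h, h1, h2⟩
    refine infAut_ext ((add_zero a.1.1).trans h.symm) (fun α => (h1 α).symm) fun α β => ?_
    have h3 := h2 α β
    rw [shifted, shifted, h, sub_eq_iff_eq_add] at h3
    rw [e, h3]
    abel

end Sections

/-! ### Splittings of the Atiyah sequence -/

section Splittings

variable {E : Type*} [NormedAddCommGroup E] [NormedSpace ℝ E] [FiniteDimensional ℝ E]
  {M : Type*} [TopologicalSpace M] [ChartedSpace E M] [IsManifold 𝓘(ℝ, E) ∞ M]
  {ι : Type*} {U : ι → Opens M}

/-- The linear isomorphism `s ⊕ i` defined by a splitting `s` of the Atiyah sequence. -/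
noncomputable def splittingEquiv (c : GerbeCocycle E U) (s : VF E M →ₗ[ℝ] InfAut c)
    (hs : ∀ X, anchor c (s X) = X) : (VF E M × LineBundle E U) ≃ₗ[ℝ] InfAut c :=
  LinearEquiv.ofBijective (s.coprod (incl c)) <| by
    have hi : ∀ a, anchor c (incl c a) = 0 := fun _ => rfl
    refine ⟨(injective_iff_map_eq_zero _).2 fun u hu => ?_, fun b => ?_⟩
    · rw [LinearMap.coprod_apply] at hu
      have h1 : u.1 = 0 := by
        have h := congrArg (anchor c) hu
        rwa [map_add, hs, hi, add_zero, map_zero] at h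
      rw [h1, map_zero, zero_add] at hu
      exact Prod.ext h1 (incl_injective c (hu.trans (map_zero _).symm))
    · have hb : b - s (anchor c b) ∈ LinearMap.ker (anchor c) := by
        rw [LinearMap.mem_ker, map_sub, hs, sub_self]
      rw [← incl_range] at hb
      obtain ⟨a, ha⟩ := hb
      exact ⟨(anchor c b, a), by rw [LinearMap.coprod_apply, ha, add_sub_cancel]⟩

lemma splittingEquiv_apply (c : GerbeCocycle E U) (s : VF E M →ₗ[ℝ] InfAut c)
    (hs : ∀ X, anchor c (s X) = X) (u : VF E M × LineBundle E U) :
    splittingEquiv c s hs u = s u.1 + incl c u.2 := rfl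

lemma atiyah_brW (c : GerbeCocycle E U) (a : InfAut c) (ε : Gauge E U) (α : ι) :
    (atiyah c).brW a ε α = actₗ a.1.1 (ε α) := rfl

/-- A homomorphic splitting `(s, s₂)` makes `s ⊕ i` a homomorphism from the standard Courant
2-algebra. The native and the Courant bracket of `(X, ξ)` and `(Y, η)` differ by the coboundary of
`½ (ι_X η - ι_Y ξ)`, which has to be subtracted from `s₂`. -/
lemma splittingEquiv_isHom (c : GerbeCocycle E U) (s : VF E M →ₗ[ℝ] InfAut c)
    (hs : ∀ X, anchor c (s X) = X) (s₂ : VF E M → VF E M → Gauge E U)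
    (h : (vectorFields E M).IsHom (atiyah c) s 0 s₂) :
    (standardCourant E U).IsHom (atiyah c) (splittingEquiv c s hs).toLinearMap LinearMap.id
      (fun u v α => s₂ u.1 v.1 α -
        (1 / 2 : ℝ) • (contractₗ u.1 (v.2.1.1 α) - contractₗ v.1 (u.2.1.1 α))) := by
  have hs' : ∀ X, (s X).1.1 = X := hs
  have hΦ : ∀ u, (splittingEquiv c s hs u).1.1 = u.1 := fun u => by
    rw [splittingEquiv_apply, infAut_add_fst, incl_fst, hs', add_zero]
  have hz : ∀ X, s₂ X 0 = 0 := fun X => (h.lin X).map_zero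
  refine
    { lin := fun u => ⟨fun v w => funext fun α => ?_, fun r v => funext fun α => ?_⟩
      skew := fun u v => funext fun α => ?_
      chain := fun ε => ?_
      map_br := fun u v => ?_
      map_brW := fun u ε => funext fun α => ?_
      map_ter := fun u v w => funext fun α => ?_ }
  · simp only [Pi.add_apply, Prod.fst_add, Prod.snd_add, (h.lin u.1).map_add, lineBundle_add_form,
      map_add, LinearMap.add_apply]
    module
  · simp only [Pi.smul_apply, Prod.smul_fst, Prod.smul_snd, (h.lin u.1).map_smul,
      lineBundle_smul_form, map_smul, LinearMap.smul_apply]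
    module
  · rw [Pi.neg_apply, h.skew u.1 v.1, Pi.neg_apply]
    module
  · change s 0 + incl c (gaugeDₗ ε) = incl c (gaugeDₗ ε)
    rw [map_zero, zero_add]
  · have hb := h.map_br u.1 v.1
    change s (bracketₗ u.1 v.1) - infAutBr c (s u.1) (s v.1) = incl c (gaugeDₗ (s₂ u.1 v.1)) at hb
    change splittingEquiv c s hs (courantBr u v) -
      infAutBr c (splittingEquiv c s hs u) (splittingEquiv c s hs v) = incl c (gaugeDₗ _)
    refine infAut_ext ?_ (fun α => ?_) fun α β => ?_
    · rw [infAut_sub_fst, hΦ, infAutBr_fst, hΦ, hΦ, courantBr_fst, sub_self, incl_fst]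
    · have hb' := congrArg (fun a : InfAut c => a.1.2.1 α) hb
      simp only [infAut_sub_form, infAutBr_form, incl_form, gaugeDₗ_form, hs'] at hb'
      rw [incl_form, gaugeDₗ_form, map_sub, ← hb']
      simp only [infAut_sub_form, infAutBr_form, splittingEquiv_apply, infAut_add_form,
        infAut_add_fst, incl_fst, hs', add_zero, incl_form, courantBr_fst, courantBr_form, map_add, map_smul]
      abel
    · have hb' := congrArg (fun a : InfAut c => a.1.2.2 α β) hb
      simp only [infAut_sub_fn, infAutBr_fn, incl_fn, gaugeDₗ_fn, hs'] at hb'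
      have hd : (gaugeDₗ fun α => s₂ u.1 v.1 α -
          (1 / 2 : ℝ) • (contractₗ u.1 (v.2.1.1 α) - contractₗ v.1 (u.2.1.1 α))).1.2 α β =
          (restrₗ inf_le_left (s₂ u.1 v.1 α) - restrₗ inf_le_right (s₂ u.1 v.1 β)) -
            (1 / 2 : ℝ) • (actₗ u.1 (v.2.1.2 α β) - actₗ v.1 (u.2.1.2 α β)) := by
        simp only [gaugeDₗ_fn, map_sub, map_smul, contractₗ_glue]
        module
      rw [incl_fn, hd, ← hb']
      simp only [infAut_sub_fn, infAutBr_fn, splittingEquiv_apply, infAut_add_fn,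
        infAut_add_fst, incl_fst, hs', add_zero, incl_fn, courantBr_fst, courantBr_fn, map_add]
      module
  · change (1 / 2 : ℝ) • actₗ u.1 (ε α) - actₗ (splittingEquiv c s hs u).1.1 (ε α) =
      s₂ u.1 0 α - (1 / 2 : ℝ) • (contractₗ u.1 (difₗ (ε α)) - contractₗ 0 (u.2.1.1 α))
    rw [hΦ, hz, contractₗ_difₗ, map_zero, LinearMap.zero_apply, Pi.zero_apply]
    module
  · have ht := congrFun (h.map_ter u.1 v.1 w.1) α
    change (0 - 0 : Fn E (U α)) =
      (s₂ (bracketₗ u.1 v.1) w.1 α - actₗ (s w.1).1.1 (s₂ u.1 v.1 α))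
        + (s₂ (bracketₗ v.1 w.1) u.1 α - actₗ (s u.1).1.1 (s₂ v.1 w.1 α))
        + (s₂ (bracketₗ w.1 u.1) v.1 α - actₗ (s v.1).1.1 (s₂ w.1 u.1 α)) at ht
    rw [hs', hs', hs'] at ht
    simp only [Pi.add_apply, Pi.sub_apply, atiyah_brW]
    change (standardCourant E U).ter u v w α - 0 = _
    change _ = (s₂ (bracketₗ u.1 v.1) w.1 α - _ - actₗ (splittingEquiv c s hs w).1.1 _)
      + (s₂ (bracketₗ v.1 w.1) u.1 α - _ - actₗ (splittingEquiv c s hs u).1.1 _)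
      + (s₂ (bracketₗ w.1 u.1) v.1 α - _ - actₗ (splittingEquiv c s hs v).1.1 _)
    rw [hΦ, hΦ, hΦ, standardCourant_ter]
    simp only [standardCourant_br, courantBr_form_courantLie, courantBr_fst, courantLie_apply,
      courantAlt_apply, map_sub, map_smul, contractₗ_lieₗ, contractₗ_difₗ,
      bracketₗ_skew v.1 u.1, bracketₗ_skew w.1 v.1, bracketₗ_skew u.1 w.1, map_neg,
      LinearMap.neg_apply]
    linear_combination (norm := module) ht

end Splittings

end HigherAtiyah

theorem mainTheorem7 {E : Type*} [NormedAddCommGroup E] [NormedSpace ℝ E] [FiniteDimensional ℝ E]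
    {M : Type*} [TopologicalSpace M] [ChartedSpace E M] [IsManifold 𝓘(ℝ, E) ∞ M] [T2Space M]
    [SigmaCompactSpace M] {ι : Type*} (U : ι → TopologicalSpace.Opens M) (hU : ⨆ α, U α = ⊤)
    (c : HigherAtiyah.GerbeCocycle E U) :
    -- the higher Atiyah sequence is a short exact sequence of Lie 2-algebras
    ((HigherAtiyah.lineBundles E U).IsLie ∧ (HigherAtiyah.atiyah c).IsLie ∧
      (HigherAtiyah.vectorFields E M).IsLie ∧ (HigherAtiyah.standardCourant E U).IsLie ∧
      (HigherAtiyah.lineBundles E U).IsHom (HigherAtiyah.atiyah c) (HigherAtiyah.incl c)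
        LinearMap.id (fun _ _ => 0) ∧
      (HigherAtiyah.atiyah c).IsHom (HigherAtiyah.vectorFields E M) (HigherAtiyah.anchor c)
        0 (fun _ _ => 0) ∧
      Function.Injective (HigherAtiyah.incl c) ∧
      LinearMap.range (HigherAtiyah.incl c) = LinearMap.ker (HigherAtiyah.anchor c) ∧
      Function.Surjective (HigherAtiyah.anchor c)) ∧
    -- sections
    (∀ (X : HigherAtiyah.VF E M) (ξ : ∀ α, HigherAtiyah.Form E (U α))
        (f : ∀ α β, HigherAtiyah.Fn E (U α ⊓ U β)),
      ((∀ α β, ∀ x ∈ U α ⊓ U β, (ξ α).1 x - (ξ β).1 x =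
            -(HigherAtiyah.contractD X (c.Λ α β)).1 x + (HigherAtiyah.dif (f α β)).1 x) ∧
          ∀ α β γ, ∀ x ∈ U α ⊓ U β ⊓ U γ,
            (f α β).1 x + (f β γ).1 x + (f γ α).1 x = 0) ↔
        ∃! a : HigherAtiyah.InfAut c,
          a.1.1 = X ∧ a.1.2.1 = ξ ∧ HigherAtiyah.shifted c a = f) ∧
    -- morphisms
    (∀ (a b : HigherAtiyah.InfAut c) (ε : HigherAtiyah.Gauge E U),
      a + (HigherAtiyah.atiyah c).del ε = b ↔
        b.1.1 = a.1.1 ∧ (∀ α, b.1.2.1 α = a.1.2.1 α + HigherAtiyah.dif (ε α)) ∧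
          ∀ α β, HigherAtiyah.shifted c b α β = HigherAtiyah.shifted c a α β +
            (HigherAtiyah.restr inf_le_left (ε α) - HigherAtiyah.restr inf_le_right (ε β))) ∧
    -- splittings
    ∀ s : HigherAtiyah.VF E M →ₗ[ℝ] HigherAtiyah.InfAut c,
      (∀ X, HigherAtiyah.anchor c (s X) = X) →
      ∃ Φ : (HigherAtiyah.VF E M × HigherAtiyah.LineBundle E U) ≃ₗ[ℝ] HigherAtiyah.InfAut c,
        (∀ u, Φ u = s u.1 + HigherAtiyah.incl c u.2) ∧
        (∀ ε, Φ ((HigherAtiyah.standardCourant E U).del ε) = (HigherAtiyah.atiyah c).del ε) ∧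
        ((HigherAtiyah.standardCourant E U).transport Φ).IsLie ∧
        (HigherAtiyah.standardCourant E U).IsHom ((HigherAtiyah.standardCourant E U).transport Φ)
          Φ.toLinearMap LinearMap.id (fun _ _ => 0) ∧
        ∀ s₂, (HigherAtiyah.vectorFields E M).IsHom (HigherAtiyah.atiyah c) s 0 s₂ →
          (∃ φ₂, (HigherAtiyah.standardCourant E U).IsHom (HigherAtiyah.atiyah c)
            Φ.toLinearMap LinearMap.id φ₂) ∧
          ∃ φ₂, ((HigherAtiyah.standardCourant E U).transport Φ).IsHom (HigherAtiyah.atiyah c)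
            LinearMap.id LinearMap.id φ₂ := by
  refine ⟨⟨HigherAtiyah.lineBundles_isLie, HigherAtiyah.atiyah_isLie c,
      HigherAtiyah.vectorFields_isLie, HigherAtiyah.standardCourant_isLie,
      HigherAtiyah.incl_isHom c, HigherAtiyah.anchor_isHom c, HigherAtiyah.incl_injective c,
      HigherAtiyah.incl_range c, HigherAtiyah.anchor_surjective hU c⟩,
    HigherAtiyah.existsUnique_shifted c, HigherAtiyah.add_del_eq_iff c, fun s hs => ?_⟩
  refine ⟨HigherAtiyah.splittingEquiv c s hs, HigherAtiyah.splittingEquiv_apply c s hs,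
    fun ε => ?_, HigherAtiyah.standardCourant_isLie.transport _,
    HigherAtiyah.standardCourant_isLie.isHom_transport _, fun s₂ h => ?_⟩
  · rw [HigherAtiyah.splittingEquiv_apply, HigherAtiyah.standardCourant_del, map_zero, zero_add]
    rfl
  · have hΦ := HigherAtiyah.splittingEquiv_isHom c s hs s₂ h
    exact ⟨⟨_, hΦ⟩, _, hΦ.of_transport⟩
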